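/- Let $R$ be a commutative ring and let $\mathcal{D}$ be an $R$-linear triangulated category (with $R$-linear shift) with arbitrary set-indexed coproducts. An object $C$ is compact if $\mathcal{D}(C,-):\mathcal{D}\to\mathrm{Mod}\text{-}R$ commutes with coproducts; $\mathcal{D}^c$ is the full subcategory of compact objects, $\mathrm{Mod}\text{-}\mathcal{D}^c$ is the category of contravariant $R$-linear functors $\mathcal{D}^c\to\mathrm{Mod}\text{-}R$, and $\mathbf{y}:\mathcal{D}\to\mathrm{Mod}\text{-}\mathcal{D}^c$, $\mathbf{y}X=\mathcal{D}(-,X)|_{\mathcal{D}^c}$, is the restricted Yoneda functor. A module $M\in\mathrm{Mod}\text{-}\mathcal{D}^c$ is cohomological if it sends every triangle $X\to Y\to Z\to X[1]$ in $\mathcal{D}^c$ to an exact sequence $M(Z)\to M(Y)\to M(X)$. For $H\in\mathcal{D}^c$, $M$ is called $H$-locally coherent if (LC1) there are $E\in\mathcal{D}^c$ and $\alpha:\mathbf{y}E\to M$ such that $\mathcal{D}^c(H,E)\to M(H)$ is surjective, and (LC2) for every $E\in\mathcal{D}^c$ and every $\beta:\mathbf{y}E\to M$ there is $f:C\to E$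 in $\mathcal{D}^c$ with $\beta\circ\mathbf{y}f=0$ and $\mathcal{D}^c(H,C)\to\mathcal{D}^c(H,E)\to M(H)$ exact. $M$ is $\mathcal{D}^c$-locally coherent if it is $H$-locally coherent for every $H\in\mathcal{D}^c$. Suppose that $\mathcal{D}$ has a compact generator $G$, that is, $G$ is compact and $X=0$ whenever $\mathcal{D}(G[i],X)=0$ for all $i\in\mathbb{Z}$. Let $\mathcal{D}_{lcoh}$ be the full subcategory of those $X\in\mathcal{D}$ for which $\mathbf{y}X$ is $G[n]$-locally coherent for every $n\in\mathbb{Z}$. Then: (1) every $X\in\mathcal{D}_{lcoh}$ is a homotopy colimit of compact objects: there are a sequence $C_0\to C_1\to C_2\to\cdots$ in $\mathcal{D}^c$ and a triangle $\coprod_{n\ge 0} C_n\xrightarrow{1-\mathrm{shift}}\coprod_{n\ge 0} C_n\to X\to(\coprod_{n\ge 0} C_n)[1]$; (2) the functor $\mathcal{D}_{lcoh}\xrightarrow{\subseteq}\mathcal{D}\xrightarrow{\mathbf{y}}\mathrm{Mod}\text{-}\mathcal{D}^c$ is full, and its essential image consists exactly of the $\mathcal{D}^c$-locally coherent cohomological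 modules; (3) every $\mathcal{D}^c$-locally coherent cohomological module has projective dimension at most $1$ in $\mathrm{Mod}\text{-}\mathcal{D}^c$. -/

import Mathlib

open CategoryTheory CategoryTheory.Limits CategoryTheory.Pretriangulated Opposite

universe w v u

namespace LocallyCoherent

section Compact

variable (R : Type w) [CommRing R] {D : Type u} [Category.{v} D] [Preadditive D]
  [CategoryTheory.Linear R D]

/-- An object `C` of an `R`-linear category `D` is compact if the covariant functor
`D(C, -) : D ⥤ Mod-R` commutes with all (set-indexed) coproducts. -/
def isCompact : ObjectProperty D := fun C =>
  ∀ J : Type v, PreservesColimitsOfShape (Discrete J) ((linearCoyoneda R D).obj (op C))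

variable (D) in
/-- The full subcategory `D^c` of compact objects of `D`. -/
abbrev Compacts := (isCompact R : ObjectProperty D).FullSubcategory

variable [HasShift D ℤ] [∀ n : ℤ, (shiftFunctor D n).Additive]
  [∀ n : ℤ, (shiftFunctor D n).Linear R]

/-- `D(C[n], X) ≅ D(C, X[-n])`, naturally in `X`. -/
noncomputable def shiftCoyonedaIso (C : D) (n : ℤ) :
    (linearCoyoneda R D).obj (op (C⟦n⟧)) ≅
      shiftFunctor D (-n) ⋙ (linearCoyoneda R D).obj (op C) :=
  NatIso.ofComponents (fun X => LinearEquiv.toModuleIso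
    (X₁ := (C⟦n⟧ ⟶ X)) (X₂ := (C ⟶ X⟦-n⟧))
    { (shiftEquiv D n).toAdjunction.homEquiv C X with
      map_add' := fun f g => by
        refine (Adjunction.homEquiv_unit _ _ _ _).trans (Eq.trans ?_ (congrArg₂ (· + ·)
          (Adjunction.homEquiv_unit _ _ _ _) (Adjunction.homEquiv_unit _ _ _ _)).symm)
        exact (congrArg _ (Functor.map_add (shiftFunctor D (-n)))).trans
          (Preadditive.comp_add _ _ _ _ _ _)
      map_smul' := fun r f => by
        refine (Adjunction.homEquiv_unit _ _ _ _).trans (Eq.trans ?_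
          (congrArg (r • ·) (Adjunction.homEquiv_unit _ _ _ _)).symm)
        exact (congrArg _ ((shiftFunctor D (-n)).map_smul r f)).trans
          (Linear.comp_smul _ _ _ _ _ _) })
    (fun {X Y} f => by
      ext g
      exact (shiftEquiv D n).toAdjunction.homEquiv_naturality_right g f)

variable {R} in
theorem isCompact_shift {C : D} (hC : isCompact R C) (n : ℤ) : isCompact R (C⟦n⟧) := by
  intro J
  have := hC J
  exact preservesColimitsOfShape_of_natIso (shiftCoyonedaIso R C n).symm

variable {R}

/-- The shift `C[n]` of a compact object, as an object of `D^c`. -/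
def shiftCompact (C : Compacts R D) (n : ℤ) : Compacts R D :=
  ⟨C.obj⟦n⟧, isCompact_shift C.property n⟩

/-- `G` is a compact generator of `D`: it is compact (by its type) and an object `X` with
`D(G[i], X) = 0` for all `i` is zero. -/
def IsCompactGenerator (G : Compacts R D) : Prop :=
  ∀ X : D, (∀ (i : ℤ) (f : G.obj⟦i⟧ ⟶ X), f = 0) → IsZero X

end Compact

section Modules

variable (R : Type w) [CommRing R] (D : Type u) [Category.{v} D] [Preadditive D]
  [CategoryTheory.Linear R D]

/-- The contravariant `R`-linear functors `D^c ⥤ Mod-R`. -/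
structure isLinearFunctor (M : (Compacts R D)ᵒᵖ ⥤ ModuleCat.{v} R) : Prop where
  additive : M.Additive
  map_smul : ∀ {X Y : Compacts R D} (f : X ⟶ Y) (r : R), M.map (r • f).op = r • M.map f.op

/-- The category `Mod-D^c` of (right) `D^c`-modules: contravariant `R`-linear functors
`D^c ⥤ Mod-R`, with natural transformations as morphisms. -/
abbrev CompactsMod :=
  ObjectProperty.FullSubcategory (C := (Compacts R D)ᵒᵖ ⥤ ModuleCat.{v} R) (isLinearFunctor R D)

/-- The restricted Yoneda functor `y : D ⥤ Mod-D^c`, `y X = D(-, X)` restricted to `D^c`. -/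
def restrictedYoneda : D ⥤ CompactsMod R D :=
  ObjectProperty.lift _
    (linearYoneda R D ⋙ (Functor.whiskeringLeft _ _ _).obj
      (isCompact R : ObjectProperty D).ι.op)
    (fun X =>
      { additive := ⟨by
          intro A B f g
          ext h
          exact Preadditive.add_comp _ _ _ _ _ _⟩
        map_smul := by
          intro A B f r
          ext h
          exact Linear.smul_comp _ _ _ _ _ _ })

instance : ObjectProperty.IsClosedUnderSubobjects
    (C := (Compacts R D)ᵒᵖ ⥤ ModuleCat.{v} R) (isLinearFunctor R D) where
  prop_of_mono {M N} i _ hN :=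
    { additive := ⟨by
        intro A B f g
        have := hN.additive
        rw [← cancel_mono (i.app B), Preadditive.add_comp, i.naturality, i.naturality,
          i.naturality, N.map_add, Preadditive.comp_add]⟩
      map_smul := by
        intro A B f r
        rw [← cancel_mono (i.app (op A)), Linear.smul_comp, i.naturality, i.naturality,
          hN.map_smul, Linear.comp_smul] }

instance : ObjectProperty.IsClosedUnderQuotients
    (C := (Compacts R D)ᵒᵖ ⥤ ModuleCat.{v} R) (isLinearFunctor R D) where
  prop_of_epi {M N} p _ hM :=
    { additive := ⟨by
        intro A B f g
        have := hM.additive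
        rw [← cancel_epi (p.app A), Preadditive.comp_add, ← p.naturality, ← p.naturality,
          ← p.naturality, M.map_add, Preadditive.add_comp]⟩
      map_smul := by
        intro A B f r
        rw [← cancel_epi (p.app (op B)), Linear.comp_smul, ← p.naturality, ← p.naturality,
          hM.map_smul, Linear.smul_comp] }

instance : ObjectProperty.ContainsZero
    (C := (Compacts R D)ᵒᵖ ⥤ ModuleCat.{v} R) (isLinearFunctor R D) where
  exists_zero := by
    have h := isZero_zero ((Compacts R D)ᵒᵖ ⥤ ModuleCat.{v} R)
    have h' := fun A => (h.obj A)
    exact ⟨_, h, ⟨⟨fun {A B f g} => (h' A).eq_of_src _ _⟩,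
      fun {A B} f r => (h' (op B)).eq_of_src _ _⟩⟩

instance : ObjectProperty.IsClosedUnderFiniteProducts
    (C := (Compacts R D)ᵒᵖ ⥤ ModuleCat.{v} R) (isLinearFunctor R D) where
  isClosedUnderLimitsOfShape J _ :=
    { limitsOfShape_le := by
        rintro M ⟨h⟩
        have hl := fun A => isLimitOfPreserves
          ((evaluation (Compacts R D)ᵒᵖ (ModuleCat.{v} R)).obj A) h.isLimit
        have ha := fun j => (h.prop_diag_obj j).additive
        refine { additive := ⟨fun {A B f g} => (hl B).hom_ext fun j => ?_⟩
                 map_smul := fun {A B} f r => (hl (op A)).hom_ext fun j => ?_ }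
        · have := ha j
          let p : M ⟶ h.diag.obj j := h.π.app j
          change M.map (f + g) ≫ p.app B = (M.map f + M.map g) ≫ p.app B
          rw [Preadditive.add_comp, p.naturality, p.naturality, p.naturality,
            Functor.map_add, Preadditive.comp_add]
        · let p : M ⟶ h.diag.obj j := h.π.app j
          change M.map (r • f).op ≫ p.app (op A) = (r • M.map f.op) ≫ p.app (op A)
          rw [Linear.smul_comp, p.naturality, p.naturality,
            (h.prop_diag_obj j).map_smul, Linear.comp_smul] }

variable {R D}

/-- `M` is `G`-locally coherent, for a compact object `G`. -/
structure IsLocallyCoherentAt (M : CompactsMod R D) (G : Compacts R D) : Prop where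
  /-- There are `E ∈ D^c` and `α : y E ⟶ M` with `D^c(G, E) ⟶ M(G)` surjective. -/
  lc1 : ∃ (E : Compacts R D) (α : (restrictedYoneda R D).obj E.obj ⟶ M),
    Function.Surjective (α.hom.app (op G))
  /-- For every `β : y E ⟶ M` with `E ∈ D^c` there is `f : C ⟶ E` in `D^c` such that
  `y f ≫ β = 0` and `D^c(G, C) ⟶ D^c(G, E) ⟶ M(G)` is exact. -/
  lc2 : ∀ (E : Compacts R D) (β : (restrictedYoneda R D).obj E.obj ⟶ M),
    ∃ (C : Compacts R D) (f : C ⟶ E), (restrictedYoneda R D).map f.hom ≫ β = 0 ∧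
      Function.Exact (((restrictedYoneda R D).map f.hom).hom.app (op G)) (β.hom.app (op G))

/-- `M` is `D^c`-locally coherent. -/
def IsLocallyCoherent (M : CompactsMod R D) : Prop :=
  ∀ G : Compacts R D, IsLocallyCoherentAt M G

variable [HasZeroObject D] [HasShift D ℤ] [∀ n : ℤ, (shiftFunctor D n).Additive]
  [Pretriangulated D]

/-- `M` is cohomological: it sends every distinguished triangle `X ⟶ Y ⟶ Z ⟶ X[1]` of
compact objects to an exact sequence `M(Z) ⟶ M(Y) ⟶ M(X)`. -/
def IsCohomological (M : CompactsMod R D) : Prop :=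
  ∀ (X Y Z : Compacts R D) (f : X ⟶ Y) (g : Y ⟶ Z) (h : Z.obj ⟶ X.obj⟦(1 : ℤ)⟧),
    Triangle.mk f.hom g.hom h ∈ distTriang D →
      Function.Exact (M.obj.map g.op) (M.obj.map f.op)

/-- `Y` is a homotopy colimit of the sequence `X 0 ⟶ X 1 ⟶ X 2 ⟶ ⋯`: there is a distinguished
triangle `∐ X n ⟶ ∐ X n ⟶ Y ⟶ (∐ X n)[1]` whose first map is `1 - shift`. -/
def IsHomotopyColimit (X : ℕ → D) (d : ∀ n, X n ⟶ X (n + 1)) (Y : D) : Prop :=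
  ∃ (c : Cofan X) (hc : IsColimit c) (p : c.pt ⟶ Y) (δ : Y ⟶ c.pt⟦(1 : ℤ)⟧),
    Triangle.mk (𝟙 c.pt - Cofan.IsColimit.desc hc (fun n => d n ≫ c.inj (n + 1))) p δ ∈
      distTriang D

variable [∀ n : ℤ, (shiftFunctor D n).Linear R]

/-- `D_lcoh`: the objects `X` with `G`-locally coherent cohomology, i.e. such that `y X` is
locally coherent at `G[n]` for every integer `n`. -/
def lcoh (G : Compacts R D) : ObjectProperty D := fun X =>
  ∀ n : ℤ, IsLocallyCoherentAt ((restrictedYoneda R D).obj X) (shiftCompact G n)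

end Modules

end LocallyCoherent

/-!
Let `M` be a cohomological module, locally coherent at the shifts of the generator `G`. Local
coherence at `H` says that an element `m` of `M(E)`, that is, a map `y E ⟶ M`, can be pushed along
a map `E ⟶ E'` of compact objects to an element which generates `M(H)`, in such a way that
`D(H, E) ⟶ D(H, E')` kills the kernel of `D(H, E) ⟶ M(H)` (`HasRefinement`). Doing this at each
shift of `G` infinitely often yields a sequence `C 0 ⟶ C 1 ⟶ ⋯` of compact objects with
`colim D(G[i], C n) = M(G[i])` for all `i` (`exists_isApproximation`). Let `Y` be its homotopy
colimit. Compact objects see only finitely many summands of a coproduct, so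
`0 ⟶ y (∐ C n) ⟶ y (∐ C n) ⟶ y Y ⟶ 0` is exact (`shortExact_hocolimShortComplex`), with
projective outer terms. Hence `y Y` has projective dimension at most one and is the colimit of the
`y (C n)`, which gives a map `y Y ⟶ M` that is bijective on the shifts of `G`.

The passage from the shifts of `G` to all compact objects is by thick induction
(`compacts_induction`): every compact object is a retract of one built from finitely many shifts of
`G` (`isCompact_le_of_generator`). The five lemma then shows that `y Y ⟶ M` is an isomorphism, and
a similar diagram chase (`HasRefinement.of_distTriang`) shows that local coherence at the shifts
of `G` implies local coherence everywhere. For `M = y X` the map `y Y ⟶ y X` comes from a map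
`Y ⟶ X`, which is an isomorphism because `G` generates; thus the objects of `D_lcoh` are homotopy
colimits of compact objects. Fullness follows, since a map `y X ⟶ y X'` is a compatible family of
maps `C n ⟶ X'` and such a family extends over the homotopy colimit `X`.
-/

namespace LocallyCoherent

/-! ### Coproducts and finitely supported maps -/

section Coproduct

variable {D : Type u} [Category.{v} D] [Preadditive D] {J : Type*} {X : J → D} {c : Cofan X}

open Classical in
/-- The projection of a coproduct, in a preadditive category, onto its `i`-th summand. -/
noncomputable def cofanProj (hc : IsColimit c) (i : J) : c.pt ⟶ X i :=
  Cofan.IsColimit.desc hc fun j => if h : j = i then eqToHom (by rw [h]) else 0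

@[simp]
theorem inj_cofanProj_self (hc : IsColimit c) (i : J) : c.inj i ≫ cofanProj hc i = 𝟙 _ := by
  simp [cofanProj]

theorem inj_cofanProj_of_ne (hc : IsColimit c) {i j : J} (h : j ≠ i) :
    c.inj j ≫ cofanProj hc i = 0 := by
  simp [cofanProj, h]

/-- The idempotent endomorphism of a coproduct projecting it onto the finitely many summands
indexed by `s`. -/
noncomputable def cofanTrunc (hc : IsColimit c) (s : Finset J) : c.pt ⟶ c.pt :=
  ∑ j ∈ s, cofanProj hc j ≫ c.inj j

theorem inj_cofanTrunc_of_mem (hc : IsColimit c) {s : Finset J} {j : J} (hj : j ∈ s) :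
    c.inj j ≫ cofanTrunc hc s = c.inj j := by
  rw [cofanTrunc, Preadditive.comp_sum, Finset.sum_eq_single j]
  · rw [← Category.assoc, inj_cofanProj_self, Category.id_comp]
  · intro i _ hi
    rw [← Category.assoc, inj_cofanProj_of_ne hc hi.symm, zero_comp]
  · exact fun h => (h hj).elim

theorem inj_cofanTrunc_of_notMem (hc : IsColimit c) {s : Finset J} {j : J} (hj : j ∉ s) :
    c.inj j ≫ cofanTrunc hc s = 0 := by
  rw [cofanTrunc, Preadditive.comp_sum]
  refine Finset.sum_eq_zero fun i hi => ?_
  rw [← Category.assoc, inj_cofanProj_of_ne hc (by rintro rfl; exact hj hi), zero_comp]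

theorem cofanTrunc_proj_of_notMem (hc : IsColimit c) {s : Finset J} {j : J} (hj : j ∉ s) :
    cofanTrunc hc s ≫ cofanProj hc j = 0 := by
  rw [cofanTrunc, Preadditive.sum_comp]
  refine Finset.sum_eq_zero fun i hi => ?_
  rw [Category.assoc, inj_cofanProj_of_ne hc (by rintro rfl; exact hj hi), comp_zero]

theorem cofanTrunc_comp_of_subset (hc : IsColimit c) {s t : Finset J} (h : s ⊆ t) :
    cofanTrunc hc s ≫ cofanTrunc hc t = cofanTrunc hc s := by
  rw [show cofanTrunc hc s = ∑ j ∈ s, cofanProj hc j ≫ c.inj j from rfl, Preadditive.sum_comp]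
  refine Finset.sum_congr rfl fun j hj => ?_
  rw [Category.assoc, inj_cofanTrunc_of_mem hc (h hj)]

theorem comp_cofanTrunc_of_subset (hc : IsColimit c) {s t : Finset J} (h : s ⊆ t) {K : D}
    {f : K ⟶ c.pt} (hf : f ≫ cofanTrunc hc s = f) : f ≫ cofanTrunc hc t = f := by
  rw [← hf, Category.assoc, cofanTrunc_comp_of_subset hc h]

/-- `K` maps finitely into coproducts: every map from `K` to a coproduct is supported on finitely
many summands. For a linear category this is compactness of `K`, see
`isCompact_iff_mapsFinitely`. -/
def MapsFinitely (K : D) : Prop :=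
  ∀ (J : Type v) (X : J → D) (c : Cofan X) (hc : IsColimit c) (f : K ⟶ c.pt),
    ∃ s : Finset J, f ≫ cofanTrunc hc s = f

/-- A family of linear maps `D(K, X j) → T` determines a linear map `D(K, ∐ X j) → T`, when
all maps `K ⟶ ∐ X j` are finitely supported. -/
noncomputable def cofanDescLinear {R : Type w} [CommRing R] [CategoryTheory.Linear R D]
    (hc : IsColimit c) {K : D} (hK : ∀ f : K ⟶ c.pt, ∃ s : Finset J, f ≫ cofanTrunc hc s = f)
    {T : Type*} [AddCommGroup T] [Module R T] (t : ∀ j, (K ⟶ X j) →ₗ[R] T) :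
    (K ⟶ c.pt) →ₗ[R] T :=
  have fin (f : K ⟶ c.pt) : (Function.support fun j => t j (f ≫ cofanProj hc j)).Finite := by
    obtain ⟨s, hs⟩ := hK f
    refine s.finite_toSet.subset fun j hj => ?_
    by_contra h
    refine hj ?_
    change t j _ = 0
    rw [← hs, Category.assoc, cofanTrunc_proj_of_notMem hc h, comp_zero, map_zero]
  { toFun := fun f => ∑ᶠ j, t j (f ≫ cofanProj hc j)
    map_add' := fun f g => by
      rw [← finsum_add_distrib (fin f) (fin g)]
      simp only [Preadditive.add_comp, map_add]
    map_smul' := fun r f => by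
      rw [RingHom.id_apply, smul_finsum' r (fin f)]
      simp only [Linear.smul_comp, map_smul] }

theorem cofanDescLinear_comp_inj {R : Type w} [CommRing R] [CategoryTheory.Linear R D]
    (hc : IsColimit c) {K : D} (hK : ∀ f : K ⟶ c.pt, ∃ s : Finset J, f ≫ cofanTrunc hc s = f)
    {T : Type*} [AddCommGroup T] [Module R T] (t : ∀ j, (K ⟶ X j) →ₗ[R] T) {j : J}
    (f : K ⟶ X j) : cofanDescLinear hc hK t (f ≫ c.inj j) = t j f := by
  change ∑ᶠ i, t i ((f ≫ c.inj j) ≫ cofanProj hc i) = _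
  rw [finsum_eq_single _ j]
  · simp
  · intro i hi
    rw [Category.assoc, inj_cofanProj_of_ne hc hi.symm, comp_zero, map_zero]

theorem addMonoidHom_ext_of_inj (hc : IsColimit c) {K : D}
    (hK : ∀ f : K ⟶ c.pt, ∃ s : Finset J, f ≫ cofanTrunc hc s = f) {T F : Type*}
    [AddCommGroup T] [FunLike F (K ⟶ c.pt) T] [AddMonoidHomClass F (K ⟶ c.pt) T] {φ ψ : F}
    (h : ∀ j (f : K ⟶ X j), φ (f ≫ c.inj j) = ψ (f ≫ c.inj j)) : φ = ψ := by
  refine DFunLike.ext _ _ fun f => ?_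
  obtain ⟨s, hs⟩ := hK f
  rw [← hs, cofanTrunc, Preadditive.comp_sum, map_sum, map_sum]
  exact Finset.sum_congr rfl fun j _ => by rw [← Category.assoc, h]

/-- The finite subcoproduct of `∐ X j` indexed by `s`, as a biproduct retract: the projection
onto the summands in `s` factors through a finite biproduct. -/
theorem cofanTrunc_eq_comp [HasFiniteBiproducts D] (hc : IsColimit c) (s : Finset J) :
    ∃ (r : c.pt ⟶ ⨁ fun j : s => X j) (i : (⨁ fun j : s => X j) ⟶ c.pt),
      i ≫ r = 𝟙 _ ∧ r ≫ i = cofanTrunc hc s := by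
  refine ⟨biproduct.lift fun j => cofanProj hc j.1, biproduct.desc fun j => c.inj j.1, ?_, ?_⟩
  · ext i j
    by_cases h : j = i
    · subst h
      simp
    · have h' : j.1 ≠ i.1 := fun h' => h (Subtype.ext h')
      simp [biproduct.ι_π_ne _ h, inj_cofanProj_of_ne hc h']
  · refine Cofan.IsColimit.hom_ext hc _ _ fun j => ?_
    by_cases hj : j ∈ s
    · have : c.inj j ≫ biproduct.lift (fun i : s => cofanProj hc i.1) =
          biproduct.ι (fun i : s => X i) ⟨j, hj⟩ := by
        ext i
        by_cases h : j = i.1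
        · obtain rfl : i = ⟨j, hj⟩ := Subtype.ext h.symm
          simp
        · rw [biproduct.ι_π_ne _ (fun h' => h (congrArg Subtype.val h')), Category.assoc,
            biproduct.lift_π, inj_cofanProj_of_ne hc h]
      rw [inj_cofanTrunc_of_mem hc hj, ← Category.assoc, this, biproduct.ι_desc]
    · have : c.inj j ≫ biproduct.lift (fun i : s => cofanProj hc i.1) = 0 := by
        ext i
        rw [Category.assoc, biproduct.lift_π, zero_comp,
          inj_cofanProj_of_ne hc (by rintro rfl; exact hj i.2)]
      rw [inj_cofanTrunc_of_notMem hc hj, ← Category.assoc, this, zero_comp]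

end Coproduct

section CompactFinite

variable {R : Type w} [CommRing R] {D : Type u} [Category.{v} D] [Preadditive D]
  [CategoryTheory.Linear R D]

/-- The finitely supported maps into a coproduct form a submodule containing the image of each
summand, and for compact `K` those images are jointly epimorphic in `Mod-R`. -/
theorem isCompact.exists_cofanTrunc {K : D} (hK : isCompact R K) {J : Type*} [Small.{v} J]
    {X : J → D} {c : Cofan X} (hc : IsColimit c) (f : K ⟶ c.pt) :
    ∃ s : Finset J, f ≫ cofanTrunc hc s = f := by
  classical
  have := hK (Shrink.{v} J)
  have : PreservesColimitsOfShape (Discrete J) ((linearCoyoneda R D).obj (op K)) :=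
    preservesColimitsOfShape_of_equiv (Discrete.equivalence (equivShrink J).symm) _
  let S : Submodule R (K ⟶ c.pt) :=
    { carrier := {f | ∃ s : Finset J, f ≫ cofanTrunc hc s = f}
      add_mem' := by
        rintro f g ⟨s, hs⟩ ⟨t, ht⟩
        refine ⟨s ∪ t, ?_⟩
        rw [Preadditive.add_comp, comp_cofanTrunc_of_subset hc Finset.subset_union_left hs,
          comp_cofanTrunc_of_subset hc Finset.subset_union_right ht]
      zero_mem' := ⟨∅, zero_comp⟩
      smul_mem' := by
        rintro r f ⟨s, hs⟩
        exact ⟨s, by rw [Linear.smul_comp, hs]⟩ }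
  have key : (ModuleCat.ofHom S.mkQ : ModuleCat.of R (K ⟶ c.pt) ⟶ _) = 0 := by
    refine (isColimitOfPreserves ((linearCoyoneda R D).obj (op K)) hc).hom_ext ?_
    rintro ⟨j⟩
    ext (g : K ⟶ X j)
    change S.mkQ (g ≫ c.inj j) = 0
    rw [Submodule.mkQ_apply, Submodule.Quotient.mk_eq_zero]
    exact ⟨{j}, by rw [Category.assoc, inj_cofanTrunc_of_mem hc (Finset.mem_singleton_self j)]⟩
  have hf : S.mkQ f = 0 := congrArg (fun φ => ModuleCat.Hom.hom φ f) key
  rwa [Submodule.mkQ_apply, Submodule.Quotient.mk_eq_zero] at hf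

theorem isCompact_iff_mapsFinitely {K : D} : isCompact R K ↔ MapsFinitely K := by
  refine ⟨fun hK J X c hc f => hK.exists_cofanTrunc hc f, fun hK J => ⟨fun {F} => ?_⟩⟩
  let F' : Discrete J ⥤ D := Discrete.functor fun j => F.obj ⟨j⟩
  have : PreservesColimit F' ((linearCoyoneda R D).obj (op K)) := ⟨fun {c} hc => ⟨by
    have hK' := hK J _ c hc
    let t (s : Cocone (F' ⋙ (linearCoyoneda R D).obj (op K))) (j : J) :
      (K ⟶ F.obj ⟨j⟩) →ₗ[R] s.pt := (s.ι.app ⟨j⟩).hom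
    refine
      { desc := fun s => ModuleCat.ofHom (cofanDescLinear hc hK' (t s))
        fac := ?_
        uniq := ?_ }
    · rintro s ⟨j⟩
      ext f
      exact cofanDescLinear_comp_inj hc hK' (t s) f
    · intro s m hm
      refine ModuleCat.hom_ext (addMonoidHom_ext_of_inj hc hK' fun j f => ?_)
      refine Eq.trans ?_ (cofanDescLinear_comp_inj hc hK' (t s) f).symm
      exact congrArg (fun φ => ModuleCat.Hom.hom φ f) (hm ⟨j⟩)⟩⟩
  exact preservesColimit_of_iso_diagram _
    (Discrete.natIso fun _ => Iso.refl _ : F' ≅ F)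

theorem isCompact_of_retract {K K' : D} (r : Retract K K') (h : isCompact R K') :
    isCompact R K := by
  rw [isCompact_iff_mapsFinitely] at h ⊢
  intro J X c hc f
  obtain ⟨s, hs⟩ := h J X c hc (r.r ≫ f)
  refine ⟨s, ?_⟩
  have := congrArg (r.i ≫ ·) hs
  simpa only [← Category.assoc, r.retract, Category.id_comp] using this

end CompactFinite

/-! ### The triangulated subcategory of compact objects -/

/-- A map `K ⟶ Y[1]` is the transpose of a map `K[-1] ⟶ Y`. -/
theorem exists_transpose {D : Type u} [Category.{v} D] [HasShift D ℤ] {K Y : D}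
    (f : K ⟶ Y⟦(1 : ℤ)⟧) :
    ∃ g : K⟦(-1 : ℤ)⟧ ⟶ Y, ∀ {Z : D} (a b : Y ⟶ Z),
      f ≫ a⟦(1 : ℤ)⟧' = f ≫ b⟦(1 : ℤ)⟧' ↔ g ≫ a = g ≫ b := by
  let A := (shiftEquiv D (1 : ℤ)).symm.toAdjunction
  refine ⟨(A.homEquiv K Y).symm f, fun {Z} a b => ?_⟩
  have key (a : Y ⟶ Z) : f ≫ a⟦(1 : ℤ)⟧' = A.homEquiv K Z ((A.homEquiv K Y).symm f ≫ a) :=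
    ((A.homEquiv_naturality_right _ a).trans
      (congrArg (· ≫ a⟦(1 : ℤ)⟧') ((A.homEquiv K Y).apply_symm_apply f))).symm
  exact (iff_of_eq (congrArg₂ _ (key a) (key b))).trans (A.homEquiv K Z).injective.eq_iff

theorem isCompact.exists_shift_cofanTrunc {R : Type w} [CommRing R] {D : Type u} [Category.{v} D]
    [Preadditive D] [CategoryTheory.Linear R D] [HasShift D ℤ]
    [∀ n : ℤ, (shiftFunctor D n).Additive] [∀ n : ℤ, (shiftFunctor D n).Linear R]
    {K : D} (hK : isCompact R K) {J : Type*} [Small.{v} J]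
    {X : J → D} {c : Cofan X} (hc : IsColimit c) (f : K ⟶ c.pt⟦(1 : ℤ)⟧) :
    ∃ s : Finset J, f ≫ (cofanTrunc hc s)⟦(1 : ℤ)⟧' = f := by
  obtain ⟨g, hg⟩ := exists_transpose f
  obtain ⟨s, hs⟩ := (isCompact_shift hK (-1)).exists_cofanTrunc hc g
  refine ⟨s, ?_⟩
  have := (hg (cofanTrunc hc s) (𝟙 _)).2 (by rw [hs, Category.comp_id])
  rwa [CategoryTheory.Functor.map_id, Category.comp_id] at this

section Triangulated

variable {R : Type w} [CommRing R] {D : Type u} [Category.{v} D] [Preadditive D]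
  [CategoryTheory.Linear R D] [HasZeroObject D] [HasShift D ℤ]
  [∀ n : ℤ, (shiftFunctor D n).Additive] [Pretriangulated D]

/-- If `f : T₂ ⟶ ∐ X j` becomes supported on `s` after restriction to `T₁`, then
`f - f ≫ cofanTrunc hc s` factors through `T₃`, and is therefore supported on a finite `t`. -/
theorem MapsFinitely.ext₂ {T : Triangle D} (hT : T ∈ distTriang D) (h₁ : MapsFinitely T.obj₁)
    (h₃ : MapsFinitely T.obj₃) : MapsFinitely T.obj₂ := by
  classical
  intro J X c hc f
  obtain ⟨s, hs⟩ := h₁ J X c hc (T.mor₁ ≫ f)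
  obtain ⟨g, hg⟩ := T.yoneda_exact₂ hT (f - f ≫ cofanTrunc hc s)
    (by rw [Preadditive.comp_sub, ← Category.assoc, hs, sub_self])
  obtain ⟨t, ht⟩ := h₃ J X c hc g
  have h : (f - f ≫ cofanTrunc hc s) ≫ cofanTrunc hc (s ∪ t) = f - f ≫ cofanTrunc hc s := by
    rw [hg, Category.assoc, comp_cofanTrunc_of_subset hc Finset.subset_union_right ht]
  rw [Preadditive.sub_comp, Category.assoc,
    cofanTrunc_comp_of_subset hc Finset.subset_union_left, sub_left_inj] at h
  exact ⟨s ∪ t, h⟩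

instance : (isCompact R : ObjectProperty D).IsClosedUnderIsomorphisms where
  of_iso {K K'} e hK := by
    rw [isCompact_iff_mapsFinitely] at hK ⊢
    intro J X c hc f
    obtain ⟨s, hs⟩ := hK J X c hc (e.hom ≫ f)
    exact ⟨s, by rwa [← cancel_epi e.hom, ← Category.assoc]⟩

instance : (isCompact R : ObjectProperty D).ContainsZero where
  exists_zero := ⟨_, isZero_zero D, isCompact_iff_mapsFinitely.2 fun _ _ _ _ _ =>
    ⟨∅, (isZero_zero D).eq_of_src _ _⟩⟩

instance : (isCompact R : ObjectProperty D).IsTriangulatedClosed₂ :=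
  .mk' fun _ hT h₁ h₃ => isCompact_iff_mapsFinitely.2
    (.ext₂ hT (isCompact_iff_mapsFinitely.1 h₁) (isCompact_iff_mapsFinitely.1 h₃))

variable [∀ n : ℤ, (shiftFunctor D n).Linear R]

instance : (isCompact R : ObjectProperty D).IsStableUnderShift ℤ where
  isStableUnderShiftBy n := ⟨fun _ hK => isCompact_shift hK n⟩

instance : (isCompact R : ObjectProperty D).IsTriangulated where

end Triangulated

/-! ### Maps from compact objects to a homotopy colimit -/

section Transition

variable {D : Type u} [Category.{v} D] {X : ℕ → D} (d : ∀ n, X n ⟶ X (n + 1))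

/-- The composite transition map `X n ⟶ X m` of a sequence. -/
noncomputable def transition {n m : ℕ} (h : n ≤ m) : X n ⟶ X m :=
  (Functor.ofSequence d).map (homOfLE h)

theorem transition_refl (n : ℕ) : transition d (le_refl n) = 𝟙 (X n) :=
  (Functor.ofSequence d).map_id n

theorem transition_comp {n m k : ℕ} (h : n ≤ m) (h' : m ≤ k) :
    transition d h ≫ transition d h' = transition d (h.trans h') :=
  ((Functor.ofSequence d).map_comp (homOfLE h) (homOfLE h')).symm

theorem transition_succ (n : ℕ) : transition d (Nat.le_succ n) = d n :=
  Functor.ofSequence_map_homOfLE_succ d n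

end Transition

section HomotopyColimit

variable {D : Type u} [Category.{v} D] [Preadditive D] {X : ℕ → D} (d : ∀ n, X n ⟶ X (n + 1))
  {c : Cofan X} (hc : IsColimit c)

/-- The endomorphism `1 - shift` of the coproduct of a sequence. -/
noncomputable def oneSubShift : c.pt ⟶ c.pt :=
  𝟙 c.pt - Cofan.IsColimit.desc hc fun n => d n ≫ c.inj (n + 1)

theorem inj_oneSubShift (n : ℕ) :
    c.inj n ≫ oneSubShift d hc = c.inj n - d n ≫ c.inj (n + 1) := by
  simp [oneSubShift]

open Classical in
/-- The map `∐ X n ⟶ X N` given by the transition maps on the summands with `n ≤ N`, and by zero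
on the others. -/
noncomputable def truncatedTransition (N : ℕ) : c.pt ⟶ X N :=
  Cofan.IsColimit.desc hc fun n => if h : n ≤ N then transition d h else 0

theorem inj_truncatedTransition {n N : ℕ} (h : n ≤ N) :
    c.inj n ≫ truncatedTransition d hc N = transition d h := by
  simp [truncatedTransition, h]

theorem inj_truncatedTransition_of_lt {n N : ℕ} (h : N < n) :
    c.inj n ≫ truncatedTransition d hc N = 0 := by
  simp [truncatedTransition, not_le.2 h]

theorem oneSubShift_comp_truncatedTransition (N : ℕ) :
    oneSubShift d hc ≫ truncatedTransition d hc N = cofanProj hc N := by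
  refine Cofan.IsColimit.hom_ext hc _ _ fun n => ?_
  rw [← Category.assoc, inj_oneSubShift, Preadditive.sub_comp, Category.assoc]
  rcases lt_trichotomy n N with h | rfl | h
  · rw [inj_truncatedTransition d hc h.le, inj_truncatedTransition d hc (Nat.succ_le_of_lt h),
      inj_cofanProj_of_ne hc h.ne, ← transition_succ d n, transition_comp, sub_self]
  · rw [inj_truncatedTransition d hc le_rfl, inj_truncatedTransition_of_lt d hc n.lt_succ_self,
      inj_cofanProj_self, transition_refl, comp_zero, sub_zero]
  · rw [inj_truncatedTransition_of_lt d hc h, inj_truncatedTransition_of_lt d hc (h.trans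
      n.lt_succ_self), inj_cofanProj_of_ne hc h.ne', comp_zero, sub_zero]

theorem inj_comp_eq_transition {Y : D} {p : c.pt ⟶ Y} (hp : oneSubShift d hc ≫ p = 0) {n m : ℕ}
    (h : n ≤ m) : c.inj n ≫ p = transition d h ≫ c.inj m ≫ p := by
  induction m, h using Nat.le_induction with
  | base => rw [transition_refl, Category.id_comp]
  | succ m h ih =>
    have h' : c.inj m ≫ oneSubShift d hc ≫ p = 0 := by rw [hp, comp_zero]
    rw [← Category.assoc, inj_oneSubShift, Preadditive.sub_comp, sub_eq_zero] at h'
    rw [ih, h', ← transition_comp d h (Nat.le_succ m), transition_succ, Category.assoc,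
      Category.assoc]

theorem oneSubShift_comp_eq_zero {Y : D} {p : c.pt ⟶ Y}
    (h : ∀ n, d n ≫ c.inj (n + 1) ≫ p = c.inj n ≫ p) : oneSubShift d hc ≫ p = 0 := by
  refine Cofan.IsColimit.hom_ext hc _ _ fun n => ?_
  rw [← Category.assoc, inj_oneSubShift, Preadditive.sub_comp, Category.assoc, h, sub_self,
    comp_zero]

variable {R : Type w} [CommRing R] [CategoryTheory.Linear R D] {K : D}

theorem eq_zero_of_comp_oneSubShift (hK : isCompact R K) {f : K ⟶ c.pt}
    (hf : f ≫ oneSubShift d hc = 0) : f = 0 := by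
  obtain ⟨s, hs⟩ := hK.exists_cofanTrunc hc f
  rw [← hs, cofanTrunc, Preadditive.comp_sum]
  refine Finset.sum_eq_zero fun n _ => ?_
  rw [← oneSubShift_comp_truncatedTransition d hc n, Category.assoc, ← Category.assoc, hf,
    zero_comp]

/-- A map from a compact object into the sequence that vanishes in the homotopy colimit vanishes
at a finite stage: `f ≫ c.inj n = g ≫ (1 - shift)`, and composing with `truncatedTransition`
identifies the image of `f` at stage `N` with the `N`-th component of `g`, zero for large `N`. -/
theorem exists_comp_transition_eq_zero (hK : isCompact R K) {n : ℕ} {f : K ⟶ X n} {g : K ⟶ c.pt}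
    (h : f ≫ c.inj n = g ≫ oneSubShift d hc) :
    ∃ (N : ℕ) (hN : n ≤ N), f ≫ transition d hN = 0 := by
  obtain ⟨s, hs⟩ := hK.exists_cofanTrunc hc g
  obtain ⟨N, hN⟩ := Infinite.exists_notMem_finset (s ∪ Finset.range n)
  rw [Finset.mem_union, Finset.mem_range, not_or, not_lt] at hN
  refine ⟨N, hN.2, ?_⟩
  rw [← inj_truncatedTransition d hc hN.2, ← Category.assoc, h, Category.assoc,
    oneSubShift_comp_truncatedTransition, ← hs, Category.assoc,
    cofanTrunc_proj_of_notMem hc hN.1, comp_zero]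

/-- A map from a compact object to the coproduct, composed with a map coequalizing `1` and
`shift`, factors through a single stage. -/
theorem exists_eq_comp_inj (hK : isCompact R K) {Y : D} {p : c.pt ⟶ Y}
    (hp : oneSubShift d hc ≫ p = 0) (f : K ⟶ c.pt) :
    ∃ (n : ℕ) (g : K ⟶ X n), f ≫ p = g ≫ c.inj n ≫ p := by
  obtain ⟨s, hs⟩ := hK.exists_cofanTrunc hc f
  rw [← hs, cofanTrunc, Preadditive.comp_sum, Preadditive.sum_comp]
  clear hs
  induction s using Finset.cons_induction with
  | empty => exact ⟨0, 0, by simp⟩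
  | cons m s hm ih =>
    obtain ⟨n, g, hg⟩ := ih
    refine ⟨max m n, (f ≫ cofanProj hc m) ≫ transition d (le_max_left m n) +
      g ≫ transition d (le_max_right m n), ?_⟩
    rw [Finset.sum_cons, hg, Preadditive.add_comp, Category.assoc _ (transition d _),
      Category.assoc g, ← inj_comp_eq_transition d hc hp, ← inj_comp_eq_transition d hc hp]
    simp only [Category.assoc]

variable [HasZeroObject D] [HasShift D ℤ] [∀ n : ℤ, (shiftFunctor D n).Additive]
  [Pretriangulated D] {Y : D} {p : c.pt ⟶ Y} {δ : Y ⟶ c.pt⟦(1 : ℤ)⟧}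
  (hT : Triangle.mk (oneSubShift d hc) p δ ∈ distTriang D)

include hT

theorem oneSubShift_comp_of_distTriang : oneSubShift d hc ≫ p = 0 :=
  comp_distTriang_mor_zero₁₂ _ hT

theorem exists_stage_eq_zero (hK : isCompact R K) {n : ℕ} {f : K ⟶ X n}
    (h : f ≫ c.inj n ≫ p = 0) : ∃ (N : ℕ) (hN : n ≤ N), f ≫ transition d hN = 0 := by
  obtain ⟨g, hg⟩ := Triangle.coyoneda_exact₂ _ hT (f ≫ c.inj n) ((Category.assoc _ _ _).trans h)
  exact exists_comp_transition_eq_zero d hc hK hg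

variable [∀ n : ℤ, (shiftFunctor D n).Linear R]

/-- `D(K, -)` of a homotopy colimit is covered by the coproduct: the connecting map vanishes on
compact objects because `1 - shift` is injective on `D(K[-1], -)`. -/
theorem exists_lift_of_isCompact (hK : isCompact R K) (f : K ⟶ Y) : ∃ g : K ⟶ c.pt, g ≫ p = f := by
  have h0 : f ≫ δ = 0 := by
    obtain ⟨g, hg⟩ := exists_transpose (f ≫ δ)
    have h : δ ≫ (oneSubShift d hc)⟦(1 : ℤ)⟧' = 0 := comp_distTriang_mor_zero₃₁ _ hT
    have h1 := (hg (oneSubShift d hc) 0).1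
      (by rw [Category.assoc, h, Functor.map_zero, comp_zero, comp_zero])
    rw [comp_zero] at h1
    have h2 := (hg (𝟙 _) 0).2
      (by rw [eq_zero_of_comp_oneSubShift d hc (isCompact_shift hK (-1)) h1, zero_comp, zero_comp])
    rwa [CategoryTheory.Functor.map_id, Category.comp_id, Functor.map_zero, comp_zero] at h2
  obtain ⟨g, hg⟩ := Triangle.coyoneda_exact₃ _ hT f h0
  exact ⟨g, hg.symm⟩

theorem exists_factor_stage (hK : isCompact R K) (f : K ⟶ Y) :
    ∃ (n : ℕ) (g : K ⟶ X n), f = g ≫ c.inj n ≫ p := by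
  obtain ⟨g, rfl⟩ := exists_lift_of_isCompact d hc hT hK f
  exact exists_eq_comp_inj d hc hK (oneSubShift_comp_of_distTriang d hc hT) g

end HomotopyColimit

theorem exists_hocolim {D : Type u} [Category.{v} D] [Preadditive D] [HasZeroObject D]
    [HasShift D ℤ] [∀ n : ℤ, (shiftFunctor D n).Additive] [Pretriangulated D] [HasCoproducts.{v} D]
    (X : ℕ → D) (d : ∀ n, X n ⟶ X (n + 1)) :
    ∃ (c : Cofan X) (hc : IsColimit c) (Y : D) (p : c.pt ⟶ Y) (δ : Y ⟶ c.pt⟦(1 : ℤ)⟧),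
      Triangle.mk (oneSubShift d hc) p δ ∈ distTriang D := by
  have : HasColimitsOfShape (Discrete ℕ) D :=
    hasColimitsOfShape_of_equivalence (Discrete.equivalence (Equiv.ulift.{v} (α := ℕ)))
  exact ⟨_, coproductIsCoproduct _, distinguished_cocone_triangle _⟩

/-! ### Compact objects are built from the generator -/

section Generation

variable {R : Type w} [CommRing R] {D : Type u} [Category.{v} D] [Preadditive D]
  [CategoryTheory.Linear R D] [HasZeroObject D] [HasShift D ℤ]
  [∀ n : ℤ, (shiftFunctor D n).Additive] [Pretriangulated D]

variable (R) in
/-- `φ` has compact kernels built from `P`: every map from a compact object that is killed by `φ`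
factors through an object of `P`. -/
def KernelFactors (P : ObjectProperty D) {Y Z : D} (φ : Y ⟶ Z) : Prop :=
  ∀ ⦃K : D⦄, isCompact R K → ∀ f : K ⟶ Y, f ≫ φ = 0 →
    ∃ (W : D) (a : K ⟶ W) (b : W ⟶ Y), P W ∧ a ≫ b = f

variable [∀ n : ℤ, (shiftFunctor D n).Linear R]

/-- A coproduct `∐ X j` of objects of `P` is attached along `a : ∐ X j ⟶ Y`, with cofibre `Y'`.
If `f : K ⟶ Y` vanishes in `Z`, then its image in `Y'` factors through some `W` in `P`. Only
finitely many summands are needed to lift `W` along `Y ⟶ Y'`, which gives an extension `W'` of `W`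
by a finite sum of `X j`; a further finite sum absorbs the discrepancy between `f` and its
factorization through `W'`. -/
theorem KernelFactors.comp_of_distTriang {P : ObjectProperty D} [P.IsTriangulated]
    [P.IsClosedUnderIsomorphisms] (hP : P ≤ isCompact R) {J : Type v} {X : J → D}
    (hX : ∀ j, P (X j)) {c : Cofan X} (hc : IsColimit c) {Y Y' Z : D} {a : c.pt ⟶ Y}
    {b : Y ⟶ Y'} {δ : Y' ⟶ c.pt⟦(1 : ℤ)⟧} (hT : Triangle.mk a b δ ∈ distTriang D) {φ : Y' ⟶ Z}
    (hφ : KernelFactors R P φ) : KernelFactors R P (b ≫ φ) := by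
  intro K hK f hf
  have hsum (s : Finset J) : P (⨁ fun j : s => X j) :=
    P.prop_of_isLimit_fan (biproduct.isLimit _) fun j => hX j.1
  have hbδ : b ≫ δ = 0 := comp_distTriang_mor_zero₂₃ _ hT
  obtain ⟨W, g, w, hW, hg⟩ := hφ hK (f ≫ b) (by rw [Category.assoc, hf])
  obtain ⟨s, hs⟩ := (hP _ hW).exists_shift_cofanTrunc hc (w ≫ δ)
  obtain ⟨r, i, -, hri⟩ := cofanTrunc_eq_comp hc s
  rw [← hri, Functor.map_comp, ← Category.assoc] at hs
  obtain ⟨W', u', q, hW'⟩ := distinguished_cocone_triangle₂ ((w ≫ δ) ≫ r⟦(1 : ℤ)⟧')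
  obtain ⟨t : W' ⟶ Y, -, ht⟩ := complete_distinguished_triangle_morphism₂ _ _ hW' hT i w hs
  change q ≫ w = t ≫ b at ht
  obtain ⟨g' : K ⟶ W', hg'⟩ := Triangle.coyoneda_exact₃ _ hW' g (by
    change g ≫ (w ≫ δ) ≫ r⟦(1 : ℤ)⟧' = 0
    rw [← Category.assoc, ← Category.assoc, hg, Category.assoc f, hbδ, comp_zero, zero_comp])
  change g = g' ≫ q at hg'
  obtain ⟨e : K ⟶ c.pt, he⟩ := Triangle.coyoneda_exact₂ _ hT (f - g' ≫ t) (by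
    change (f - g' ≫ t) ≫ b = 0
    rw [Preadditive.sub_comp, Category.assoc, ← ht, ← Category.assoc, ← hg', hg, sub_self])
  change f - g' ≫ t = e ≫ a at he
  obtain ⟨s', hs'⟩ := hK.exists_cofanTrunc hc e
  obtain ⟨r', i', -, hri'⟩ := cofanTrunc_eq_comp hc s'
  refine ⟨W' ⊞ ⨁ fun j : s' => X j, biprod.lift g' (e ≫ r'), biprod.desc t (i' ≫ a), ?_, ?_⟩
  · exact P.ext_of_isTriangulatedClosed₂ _ (binaryBiproductTriangle_distinguished _ _)
      (P.ext_of_isTriangulatedClosed₂ _ hW' (hsum s) hW) (hsum s')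
  · rw [biprod.lift_desc, Category.assoc, ← Category.assoc r', hri', ← Category.assoc e, hs', ← he,
      add_sub_cancel]

/-- Attaching a coproduct of shifts of `G` kills all maps from shifts of `G` to `Y`. -/
theorem exists_killing_triangle [HasCoproducts.{v} D] (G Y : D) :
    ∃ (J : Type v) (n : J → ℤ) (c : Cofan fun j => G⟦n j⟧) (_ : IsColimit c) (Y' : D)
      (a : c.pt ⟶ Y) (b : Y ⟶ Y') (δ : Y' ⟶ c.pt⟦(1 : ℤ)⟧), Triangle.mk a b δ ∈ distTriang D ∧
        ∀ (i : ℤ) (f : G⟦i⟧ ⟶ Y), f ≫ b = 0 := by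
  let J := Σ i : ℤ, (G⟦i⟧ ⟶ Y)
  let X (j : J) : D := G⟦j.1⟧
  let a : ∐ X ⟶ Y := Sigma.desc fun j => j.2
  obtain ⟨Y', b, δ, hT⟩ := distinguished_cocone_triangle a
  refine ⟨J, Sigma.fst, _, coproductIsCoproduct X, Y', a, b, δ, hT, fun i f => ?_⟩
  have hab : a ≫ b = 0 := comp_distTriang_mor_zero₁₂ _ hT
  have hf : f = Sigma.ι X ⟨i, f⟩ ≫ a := (Sigma.ι_desc (fun j : J => j.2) (⟨i, f⟩ : J)).symm
  rw [hf, Category.assoc, hab, comp_zero]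

/-- The compact objects form the thick subcategory generated by a compact generator `G`.

Starting from a compact object `H`, successively kill all maps from shifts of `G`. The homotopy
colimit of the resulting sequence receives no map from a shift of `G`, so it is zero; as `H` is
compact, `H` already maps by zero to a finite stage, and `KernelFactors.comp_of_distTriang`
factors the identity of `H` through an object built from finitely many shifts of `G`. -/
theorem isCompact_le_of_generator [HasCoproducts.{v} D] {G : Compacts R D}
    (hG : IsCompactGenerator G) (Q : ObjectProperty D) [Q.IsTriangulated]
    [Q.IsClosedUnderIsomorphisms] [Q.IsStableUnderRetracts] (hQ : Q G.obj) :
    (isCompact R : ObjectProperty D) ≤ Q := by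
  intro H hH
  choose J n c hc Y' a b δ hT hb using fun Y : D => exists_killing_triangle G.obj Y
  let X (k : ℕ) : D := Y'^[k] H
  have hX (k : ℕ) : X (k + 1) = Y' (X k) := Function.iterate_succ_apply' _ _ _
  let d (k : ℕ) : X k ⟶ X (k + 1) := b (X k) ≫ eqToHom (hX k).symm
  have hd (k : ℕ) (i : ℤ) (f : G.obj⟦i⟧ ⟶ X k) : f ≫ d k = 0 := by
    rw [← Category.assoc, hb, zero_comp]
  obtain ⟨_, hX', Z, p, ε, hZ⟩ := exists_hocolim X d
  have hp := oneSubShift_comp_of_distTriang d hX' hZ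
  have hZ0 : IsZero Z := hG Z fun i f => by
    obtain ⟨k, g, rfl⟩ := exists_factor_stage d hX' hZ (isCompact_shift G.property i) f
    rw [inj_comp_eq_transition d hX' hp (Nat.le_succ k), transition_succ, ← Category.assoc, hd,
      zero_comp]
  obtain ⟨N, hN, h0⟩ := exists_stage_eq_zero (n := 0) d hX' hZ hH (f := 𝟙 H) (hZ0.eq_of_tgt _ _)
  let P : ObjectProperty D := Q ⊓ isCompact R
  have hP : P ≤ isCompact R := inf_le_right
  have hPG (i : ℤ) : P (G.obj⟦i⟧) := P.le_shift i _ ⟨hQ, G.property⟩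
  have key (k : ℕ) (hk : k ≤ N) : KernelFactors R P (transition d hk) := by
    induction hk using Nat.decreasingInduction with
    | self =>
      intro K _ f hf
      rw [transition_refl, Category.comp_id] at hf
      obtain ⟨W, hW, hW'⟩ := P.exists_prop_of_containsZero
      exact ⟨W, 0, 0, hW', by rw [hf, zero_comp]⟩
    | of_succ k hk ih =>
      rw [← transition_comp d (Nat.le_succ k) hk, transition_succ, Category.assoc]
      refine KernelFactors.comp_of_distTriang hP (fun j => hPG (n _ j)) (hc _) (hT _) ?_
      intro K hK f hf
      obtain ⟨W, g, h, hW, hgh⟩ := ih hK (f ≫ eqToHom (hX k).symm) (by rwa [Category.assoc])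
      exact ⟨W, g, h ≫ eqToHom (hX k), hW, by rw [← Category.assoc, hgh]; simp⟩
  obtain ⟨W, g, h, hW, hgh⟩ := key 0 hN hH (𝟙 H) h0
  exact Q.prop_of_retract ⟨g, h, hgh⟩ hW.1

end Generation

/-! ### Triangles of compact objects -/

section CompactTriangles

variable {R : Type w} [CommRing R] {D : Type u} [Category.{v} D] [Preadditive D]
  [CategoryTheory.Linear R D] [HasZeroObject D] [HasShift D ℤ]
  [∀ n : ℤ, (shiftFunctor D n).Additive] [Pretriangulated D]

section Exactness

variable {X Y Z : Compacts R D} {f : X ⟶ Y} {g : Y ⟶ Z} {h : Z.obj ⟶ X.obj⟦(1 : ℤ)⟧}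
  (hT : Triangle.mk f.hom g.hom h ∈ distTriang D)

include hT

theorem compacts_comp_eq_zero : f ≫ g = 0 :=
  ObjectProperty.hom_ext _ (comp_distTriang_mor_zero₁₂ _ hT)

theorem compacts_exists_desc {W : Compacts R D} (k : Y ⟶ W) (hk : f ≫ k = 0) :
    ∃ l : Z ⟶ W, k = g ≫ l := by
  obtain ⟨l, hl⟩ := Triangle.yoneda_exact₂ _ hT k.hom (congrArg (fun φ => φ.hom) hk)
  exact ⟨ObjectProperty.homMk l, ObjectProperty.hom_ext _ hl⟩

theorem compacts_exists_lift {W : Compacts R D} (k : W ⟶ Y) (hk : k ≫ g = 0) :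
    ∃ l : W ⟶ X, k = l ≫ f := by
  obtain ⟨l, hl⟩ := Triangle.coyoneda_exact₂ _ hT k.hom (congrArg (fun φ => φ.hom) hk)
  exact ⟨ObjectProperty.homMk l, ObjectProperty.hom_ext _ hl⟩

variable [∀ n : ℤ, (shiftFunctor D n).Linear R]

theorem compacts_rotate : ∃ (a : Z ⟶ shiftCompact X 1)
    (b : (shiftCompact X 1).obj ⟶ Y.obj⟦(1 : ℤ)⟧), Triangle.mk g.hom a.hom b ∈ distTriang D :=
  ⟨ObjectProperty.homMk h, _, rot_of_distTriang _ hT⟩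

theorem compacts_invRotate : ∃ (a : shiftCompact Z (-1) ⟶ X)
    (b : Y.obj ⟶ (shiftCompact Z (-1)).obj⟦(1 : ℤ)⟧), Triangle.mk a.hom f.hom b ∈ distTriang D :=
  ⟨ObjectProperty.homMk (Triangle.invRotate (Triangle.mk f.hom g.hom h)).mor₁, _,
    inv_rot_of_distTriang _ hT⟩

end Exactness

variable [∀ n : ℤ, (shiftFunctor D n).Linear R]

theorem compacts_exists_cone {X Y : Compacts R D} (f : X ⟶ Y) :
    ∃ (Z : Compacts R D) (g : Y ⟶ Z) (h : Z.obj ⟶ X.obj⟦(1 : ℤ)⟧),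
      Triangle.mk f.hom g.hom h ∈ distTriang D := by
  obtain ⟨Z, hZ, g, h, hT⟩ := ObjectProperty.distinguished_cocone_triangle (isCompact R) f.hom
    X.property Y.property
  exact ⟨⟨Z, hZ⟩, ObjectProperty.homMk g, h, hT⟩

theorem compacts_exists_fiber {Y Z : Compacts R D} (g : Y ⟶ Z) :
    ∃ (X : Compacts R D) (f : X ⟶ Y) (h : Z.obj ⟶ X.obj⟦(1 : ℤ)⟧),
      Triangle.mk f.hom g.hom h ∈ distTriang D := by
  obtain ⟨X, hX, f, h, hT⟩ := ObjectProperty.distinguished_cocone_triangle₁ (isCompact R) g.hom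
    Y.property Z.property
  exact ⟨⟨X, hX⟩, ObjectProperty.homMk f, h, hT⟩

/-- Thick induction on compact objects: to prove `A` for all compact objects it suffices to prove
it for the shifts of a compact generator, provided that `A` passes to zero objects, to retracts,
and from (suitable shifts of) the outer terms of a triangle to the middle term. -/
theorem compacts_induction [HasCoproducts.{v} D] {G : Compacts R D} (hG : IsCompactGenerator G)
    {A : Compacts R D → Prop} (zero : ∀ K, IsZero K.obj → A K)
    (retract : ∀ {K K' : Compacts R D}, Retract K K' → A K' → A K)
    (ext : ∀ {X Y Z : Compacts R D} (f : X ⟶ Y) (g : Y ⟶ Z) (h : Z.obj ⟶ X.obj⟦(1 : ℤ)⟧),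
      Triangle.mk f.hom g.hom h ∈ distTriang D → A X → A Z → A (shiftCompact X 1) →
        A (shiftCompact Z (-1)) → A Y)
    (gen : ∀ n : ℤ, A (shiftCompact G n)) (K : Compacts R D) : A K := by
  have retract' {K K' : Compacts R D} (r : Retract K.obj K'.obj) : A K' → A K :=
    retract ⟨ObjectProperty.homMk r.i, ObjectProperty.homMk r.r,
      ObjectProperty.hom_ext _ r.retract⟩
  let Q : ObjectProperty D := fun H => ∃ hH : isCompact R H, ∀ n : ℤ, A (shiftCompact ⟨H, hH⟩ n)
  have hshift {H : D} (hH : isCompact R H) (h : ∀ n : ℤ, A (shiftCompact ⟨H, hH⟩ n)) (m n : ℤ) :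
      A (shiftCompact (shiftCompact ⟨H, hH⟩ m) n) :=
    retract' (K' := shiftCompact ⟨H, hH⟩ (m + n))
      (Retract.ofIso ((shiftFunctorAdd D m n).symm.app H)) (h (m + n))
  have : Q.IsStableUnderRetracts := ⟨fun r ⟨hH, h⟩ => ⟨isCompact_of_retract r hH, fun n =>
    retract' (K' := shiftCompact ⟨_, hH⟩ n) (r.map (shiftFunctor D n)) (h n)⟩⟩
  have : Q.IsClosedUnderIsomorphisms := ⟨fun e h => Q.prop_of_retract (Retract.ofIso e.symm) h⟩
  have : Q.ContainsZero := ⟨⟨_, isZero_zero D, (isCompact R).prop_of_isZero (isZero_zero D),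
    fun n => zero _ ((shiftFunctor D n).map_isZero (isZero_zero D))⟩⟩
  have : Q.IsStableUnderShift ℤ := ⟨fun m => ⟨fun H ⟨hH, h⟩ =>
    ⟨isCompact_shift hH m, fun n => hshift hH h m n⟩⟩⟩
  have : Q.IsTriangulatedClosed₂ := .mk' fun T hT ⟨h₁, h₁'⟩ ⟨h₃, h₃'⟩ => by
    have h₂ : isCompact R T.obj₂ :=
      (isCompact R).ext_of_isTriangulatedClosed₂ T hT h₁ h₃
    refine ⟨h₂, fun n => ?_⟩
    have hTn := Triangle.shift_distinguished T hT n
    exact ext (X := shiftCompact ⟨_, h₁⟩ n) (Y := shiftCompact ⟨_, h₂⟩ n)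
      (Z := shiftCompact ⟨_, h₃⟩ n) (ObjectProperty.homMk _) (ObjectProperty.homMk _) _ hTn
      (h₁' n) (h₃' n) (hshift h₁ h₁' n 1) (hshift h₃ h₃' n (-1))
  have : Q.IsTriangulated := {}
  obtain ⟨hK, h⟩ := isCompact_le_of_generator hG Q ⟨G.property, gen⟩ K.obj K.property
  exact retract' (K' := shiftCompact ⟨_, hK⟩ 0)
    (Retract.ofIso ((shiftFunctorZero D ℤ).symm.app K.obj)) (h 0)

end CompactTriangles

/-! ### Elements of modules over the compact objects -/

section Modules

variable {R : Type w} [CommRing R] {D : Type u} [Category.{v} D] [Preadditive D]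
  [CategoryTheory.Linear R D] {M N : CompactsMod R D} {K K' E : Compacts R D}

/-- The restriction `M(E) ⟶ M(K)` of an element along a map `K ⟶ E` of compact objects. -/
def pull (f : K ⟶ E) (m : M.obj.obj (op E)) : M.obj.obj (op K) := M.obj.map f.op m

theorem pull_comp (f : K' ⟶ K) (g : K ⟶ E) (m : M.obj.obj (op E)) :
    pull (f ≫ g) m = pull f (pull g m) := by
  simp [pull]

theorem pull_id (m : M.obj.obj (op E)) : pull (𝟙 E) m = m := by
  simp [pull]

@[simp]
theorem pull_zero (f : K ⟶ E) : pull f (0 : M.obj.obj (op E)) = 0 :=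
  map_zero (M.obj.map f.op).hom

theorem pull_add (f : K ⟶ E) (m m' : M.obj.obj (op E)) :
    pull f (m + m') = pull f m + pull f m' :=
  map_add (M.obj.map f.op).hom m m'

theorem pull_sub (f : K ⟶ E) (m m' : M.obj.obj (op E)) :
    pull f (m - m') = pull f m - pull f m' :=
  map_sub (M.obj.map f.op).hom m m'

theorem add_pull (f g : K ⟶ E) (m : M.obj.obj (op E)) : pull (f + g) m = pull f m + pull g m := by
  have := M.property.additive
  have h : M.obj.map (f + g).op = M.obj.map f.op + M.obj.map g.op := M.obj.map_add
  exact congrArg (fun φ => ModuleCat.Hom.hom φ m) h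

theorem smul_pull (f : K ⟶ E) (r : R) (m : M.obj.obj (op E)) : pull (r • f) m = r • pull f m :=
  congrArg (fun φ => ModuleCat.Hom.hom φ m) (M.property.map_smul f r)

theorem zero_pull (m : M.obj.obj (op E)) : pull (0 : K ⟶ E) m = 0 := by
  simpa using smul_pull (0 : K ⟶ E) (0 : R) m

theorem sub_pull (f g : K ⟶ E) (m : M.obj.obj (op E)) : pull (f - g) m = pull f m - pull g m := by
  rw [eq_sub_iff_add_eq, ← add_pull, sub_add_cancel]

theorem app_pull (φ : M ⟶ N) (f : K ⟶ E) (m : M.obj.obj (op E)) :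
    φ.hom.app (op K) (pull f m) = pull f (φ.hom.app (op E) m) :=
  congrArg (fun ψ => ModuleCat.Hom.hom ψ m) (φ.hom.naturality f.op)

/-- A map out of a representable module is evaluated on `f` by restricting, along `f`, its value
at the identity. -/
theorem app_eq_pull {X : D} (φ : (restrictedYoneda R D).obj X ⟶ M) (f : K ⟶ E) (g : E.obj ⟶ X) :
    φ.hom.app (op K) (f.hom ≫ g : K.obj ⟶ X) = pull f (φ.hom.app (op E) g) :=
  app_pull φ f (M := (restrictedYoneda R D).obj X) g

theorem app_eq_pull_id (φ : (restrictedYoneda R D).obj E.obj ⟶ M) (f : K ⟶ E) :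
    φ.hom.app (op K) f.hom = pull f (φ.hom.app (op E) (𝟙 E.obj)) := by
  rw [← app_eq_pull, Category.comp_id]

/-- The map `D(K, E) ⟶ M(K)` given by restricting a fixed element of `M(E)`. -/
def pullLinear (K : Compacts R D) (m : M.obj.obj (op E)) :
    (K.obj ⟶ E.obj) →ₗ[R] M.obj.obj (op K) where
  toFun f := pull (ObjectProperty.homMk f) m
  map_add' f g := add_pull (ObjectProperty.homMk f) (ObjectProperty.homMk g) m
  map_smul' r f := smul_pull (ObjectProperty.homMk f) r m

/-- The map out of a representable module determined by an element. -/
def ofElement (m : M.obj.obj (op E)) : (restrictedYoneda R D).obj E.obj ⟶ M :=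
  ObjectProperty.homMk
    { app := fun K => ModuleCat.ofHom (pullLinear K.unop m)
      naturality := fun K K' f => by
        ext (g : K.unop.obj ⟶ E.obj)
        exact pull_comp f.unop (ObjectProperty.homMk g) m }

theorem ofElement_app (m : M.obj.obj (op E)) (f : K ⟶ E) :
    (ofElement m).hom.app (op K) f.hom = pull f m := rfl

theorem hom_app_inv_app (e : M ≅ N) (x : N.obj.obj (op K)) :
    e.hom.hom.app (op K) (e.inv.hom.app (op K) x) = x :=
  congrArg (fun φ => (ModuleCat.Hom.hom (φ.hom.app (op K))) x) e.inv_hom_id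

theorem bijective_app_of_retract (φ : N ⟶ M) {K K' : Compacts R D} (r : Retract K K')
    (h : Function.Bijective (φ.hom.app (op K'))) : Function.Bijective (φ.hom.app (op K)) := by
  constructor
  · intro x y hxy
    have : pull r.r x = pull r.r y := h.1 (by rw [app_pull, app_pull, hxy])
    have := congrArg (pull r.i) this
    rwa [← pull_comp, ← pull_comp, r.retract, pull_id, pull_id] at this
  · intro m
    obtain ⟨n, hn⟩ := h.2 (pull r.r m)
    exact ⟨pull r.i n, by rw [app_pull, hn, ← pull_comp, r.retract, pull_id]⟩

theorem eq_zero_of_isZero {K : Compacts R D} (hK : IsZero K.obj) (m : M.obj.obj (op K)) :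
    m = 0 := by
  have h : 𝟙 K = 0 := ObjectProperty.hom_ext _ (hK.eq_of_src _ _)
  rw [← pull_id m, h, zero_pull]

theorem isIso_of_bijective_app (φ : N ⟶ M)
    (h : ∀ K : Compacts R D, Function.Bijective (φ.hom.app (op K))) : IsIso φ := by
  rw [← ObjectProperty.isIso_hom_iff]
  have (K : (Compacts R D)ᵒᵖ) : IsIso (φ.hom.app K) :=
    (ConcreteCategory.isIso_iff_bijective _).2 (h K.unop)
  exact NatIso.isIso_of_isIso_app φ.hom

end Modules

/-! ### Cohomological modules -/

section Cohomological

variable {R : Type w} [CommRing R] {D : Type u} [Category.{v} D] [Preadditive D]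
  [CategoryTheory.Linear R D] [HasZeroObject D] [HasShift D ℤ]
  [∀ n : ℤ, (shiftFunctor D n).Additive] [Pretriangulated D]
  {M N : CompactsMod R D}

theorem IsCohomological.exists_pull_eq (hM : IsCohomological M) {X Y Z : Compacts R D} {f : X ⟶ Y}
    {g : Y ⟶ Z} {h : Z.obj ⟶ X.obj⟦(1 : ℤ)⟧} (hT : Triangle.mk f.hom g.hom h ∈ distTriang D)
    (m : M.obj.obj (op Y)) (hm : pull f m = 0) : ∃ z : M.obj.obj (op Z), pull g z = m :=
  (hM X Y Z f g h hT m).1 hm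

theorem IsCohomological.of_iso (hM : IsCohomological M) (e : M ≅ N) : IsCohomological N := by
  intro X Y Z f g h hT n
  change pull f n = 0 ↔ ∃ z, pull g z = n
  constructor
  · intro hn
    obtain ⟨z, hz⟩ := hM.exists_pull_eq hT (e.inv.hom.app (op Y) n)
      (by rw [← app_pull, hn, map_zero])
    exact ⟨e.hom.hom.app (op Z) z, by rw [← app_pull, hz, hom_app_inv_app]⟩
  · rintro ⟨z, rfl⟩
    rw [← pull_comp, compacts_comp_eq_zero hT, zero_pull]

theorem isCohomological_restrictedYoneda (X : D) :
    IsCohomological ((restrictedYoneda R D).obj X) := by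
  intro A B C f g h hT (k : B.obj ⟶ X)
  constructor
  · intro hk
    obtain ⟨l, hl⟩ := Triangle.yoneda_exact₂ _ hT k hk
    exact ⟨l, hl.symm⟩
  · rintro ⟨l, rfl⟩
    exact (Category.assoc _ _ _).symm.trans
      ((congrArg (· ≫ (l : C.obj ⟶ X)) (comp_distTriang_mor_zero₁₂ _ hT)).trans zero_comp)

variable [∀ n : ℤ, (shiftFunctor D n).Linear R]

/-- The five lemma for `Z[-1] ⟶ X ⟶ Y ⟶ Z ⟶ X[1]`. -/
theorem bijective_app_of_distTriang (hN : IsCohomological N) (hM : IsCohomological M) (φ : N ⟶ M)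
    {X Y Z : Compacts R D} {f : X ⟶ Y} {g : Y ⟶ Z} {h : Z.obj ⟶ X.obj⟦(1 : ℤ)⟧}
    (hT : Triangle.mk f.hom g.hom h ∈ distTriang D)
    (hX : Function.Bijective (φ.hom.app (op X))) (hZ : Function.Bijective (φ.hom.app (op Z)))
    (hX' : Function.Bijective (φ.hom.app (op (shiftCompact X 1))))
    (hZ' : Function.Bijective (φ.hom.app (op (shiftCompact Z (-1))))) :
    Function.Bijective (φ.hom.app (op Y)) := by
  obtain ⟨a, b, hab⟩ := compacts_rotate hT
  obtain ⟨a', b', hab'⟩ := compacts_invRotate hT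
  constructor
  · rw [injective_iff_map_eq_zero]
    intro n hn
    obtain ⟨z, rfl⟩ := hN.exists_pull_eq hT n (hX.1 (by rw [app_pull, hn, pull_zero, map_zero]))
    rw [app_pull] at hn
    obtain ⟨x, hx⟩ := hM.exists_pull_eq hab _ hn
    obtain ⟨x, rfl⟩ := hX'.2 x
    rw [← app_pull] at hx
    rw [← hZ.1 hx, ← pull_comp, compacts_comp_eq_zero hab, zero_pull]
  · intro m
    obtain ⟨x, hx⟩ := hX.2 (pull f m)
    obtain ⟨y, rfl⟩ := hN.exists_pull_eq hab' x (hZ'.1 (by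
      rw [app_pull, hx, ← pull_comp, compacts_comp_eq_zero hab', zero_pull, map_zero]))
    obtain ⟨z, hz⟩ := hM.exists_pull_eq hT (m - φ.hom.app (op Y) y)
      (by rw [pull_sub, ← hx, app_pull, sub_self])
    obtain ⟨z, rfl⟩ := hZ.2 z
    exact ⟨y + pull g z, by rw [map_add, app_pull, hz, add_sub_cancel]⟩

/-- A map of cohomological modules that is bijective on the shifts of a compact generator is an
isomorphism. -/
theorem isIso_of_bijective_on_generator [HasCoproducts.{v} D] {G : Compacts R D}
    (hG : IsCompactGenerator G) (hN : IsCohomological N) (hM : IsCohomological M) (φ : N ⟶ M)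
    (h : ∀ n : ℤ, Function.Bijective (φ.hom.app (op (shiftCompact G n)))) : IsIso φ :=
  isIso_of_bijective_app φ <| compacts_induction hG
    (A := fun K => Function.Bijective (φ.hom.app (op K)))
    (fun _ hK => ⟨fun x y _ => by rw [eq_zero_of_isZero hK x, eq_zero_of_isZero hK y],
      fun m => ⟨0, by rw [eq_zero_of_isZero hK m, map_zero]⟩⟩)
    (bijective_app_of_retract φ)
    (fun _ _ _ hT hX hZ hX' hZ' => bijective_app_of_distTriang hN hM φ hT hX hZ hX' hZ') h

end Cohomological

/-! ### Local coherence as refinement of elements -/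

section Refinement

variable {R : Type w} [CommRing R] {D : Type u} [Category.{v} D] [Preadditive D]
  [CategoryTheory.Linear R D] {M N : CompactsMod R D}

/-- `D(H, E) ⟶ M(H)`, given by the element `m` of `M(E)`, is surjective. -/
def GeneratesAt (H : Compacts R D) {E : Compacts R D} (m : M.obj.obj (op E)) : Prop :=
  ∀ x : M.obj.obj (op H), ∃ f : H ⟶ E, pull f m = x

/-- `g` kills the kernel of the map `D(H, E) ⟶ M(H)` given by the element `m` of `M(E)`. -/
def KillsKernelAt (H : Compacts R D) {E E' : Compacts R D} (m : M.obj.obj (op E)) (g : E ⟶ E') :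
    Prop :=
  ∀ f : H ⟶ E, pull f m = 0 → f ≫ g = 0

/-- Every element `m` of `M` extends along some map of compact objects to an element generating
`M` at `H`, in such a way that the relations satisfied by `m` at `H` become trivial. For
cohomological modules this is local coherence at `H`, see
`isLocallyCoherentAt_iff_hasRefinement`; in this form it can be iterated. -/
def HasRefinement (M : CompactsMod R D) (H : Compacts R D) : Prop :=
  ∀ (E : Compacts R D) (m : M.obj.obj (op E)), ∃ (E' : Compacts R D) (g : E ⟶ E')
    (m' : M.obj.obj (op E')), pull g m' = m ∧ GeneratesAt H m' ∧ KillsKernelAt H m g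

theorem HasRefinement.of_retract {K K' : Compacts R D} (r : Retract K K')
    (h : HasRefinement M K') : HasRefinement M K := by
  intro E m
  obtain ⟨E', g, m', hg, hgen, hkill⟩ := h E m
  refine ⟨E', g, m', hg, fun x => ?_, fun f hf => ?_⟩
  · obtain ⟨f, hf⟩ := hgen (pull r.r x)
    exact ⟨r.i ≫ f, by rw [pull_comp, hf, ← pull_comp, r.retract, pull_id]⟩
  · have := hkill (r.r ≫ f) (by rw [pull_comp, hf, pull_zero])
    have := congrArg (r.i ≫ ·) this
    simpa only [← Category.assoc, r.retract, Category.id_comp, comp_zero] using this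

theorem IsLocallyCoherentAt.of_iso {H : Compacts R D} (h : IsLocallyCoherentAt M H) (e : M ≅ N) :
    IsLocallyCoherentAt N H := by
  constructor
  · obtain ⟨E, α, hα⟩ := h.lc1
    refine ⟨E, α ≫ e.hom, fun x => ?_⟩
    obtain ⟨f, hf⟩ := hα (e.inv.hom.app (op H) x)
    exact ⟨f, (congrArg (e.hom.hom.app (op H)) hf).trans (hom_app_inv_app e x)⟩
  · intro E β
    obtain ⟨C, f, hf, hex⟩ := h.lc2 E (β ≫ e.inv)
    refine ⟨C, f, ?_, fun x => ?_⟩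
    · rw [← cancel_mono e.inv, Category.assoc, hf, zero_comp]
    · refine Iff.trans ?_ (hex x)
      change _ ↔ e.inv.hom.app (op H) (β.hom.app (op H) x) = 0
      constructor
      · intro hx
        rw [hx, map_zero]
      · intro hx
        rw [← hom_app_inv_app e (β.hom.app (op H) x), hx, map_zero]

theorem hasRefinement_of_isZero {K : Compacts R D} (hK : IsZero K.obj) : HasRefinement M K :=
  fun E m => ⟨E, 𝟙 E, m, pull_id m, fun x => ⟨0, by
    have h : 𝟙 K = 0 := ObjectProperty.hom_ext _ (hK.eq_of_src _ _)
    rw [zero_pull, ← pull_id x, h, zero_pull]⟩,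
    fun _ _ => ObjectProperty.hom_ext _ (hK.eq_of_src _ _)⟩

variable [HasZeroObject D] [HasShift D ℤ] [∀ n : ℤ, (shiftFunctor D n).Additive]
  [Pretriangulated D] [∀ n : ℤ, (shiftFunctor D n).Linear R]

/-- Refinement at `X`, `X[1]`, `Z` and `Z[-1]` in turn gives refinement at `Y`, by a diagram chase
as for the five lemma. -/
theorem HasRefinement.of_distTriang (hM : IsCohomological M) {X Y Z : Compacts R D} {u : X ⟶ Y}
    {p : Y ⟶ Z} {h : Z.obj ⟶ X.obj⟦(1 : ℤ)⟧} (hT : Triangle.mk u.hom p.hom h ∈ distTriang D)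
    (hX : HasRefinement M X) (hZ : HasRefinement M Z) (hX' : HasRefinement M (shiftCompact X 1))
    (hZ' : HasRefinement M (shiftCompact Z (-1))) : HasRefinement M Y := by
  obtain ⟨a, b, hab⟩ := compacts_rotate hT
  obtain ⟨a', b', hab'⟩ := compacts_invRotate hT
  intro E m
  obtain ⟨E₁, g₁, m₁, rfl, gen₁, kill₁⟩ := hX E m
  obtain ⟨E₂, g₂, m₂, rfl, gen₂, kill₂⟩ := hX' E₁ m₁
  obtain ⟨E₃, g₃, m₃, rfl, gen₃, kill₃⟩ := hZ E₂ m₂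
  obtain ⟨E₄, g₄, m₄, rfl, gen₄, kill₄⟩ := hZ' E₃ m₃
  refine ⟨E₄, g₁ ≫ g₂ ≫ g₃ ≫ g₄, m₄, by simp only [pull_comp], fun x => ?_, fun f hf => ?_⟩
  · obtain ⟨f, hf⟩ := gen₁ (pull u x)
    have h0 : (a' ≫ f ≫ g₂ ≫ g₃) ≫ g₄ = 0 := kill₄ _ (by
      rw [pull_comp, pull_comp, pull_comp, hf, ← pull_comp, compacts_comp_eq_zero hab', zero_pull])
    obtain ⟨k, hk⟩ := compacts_exists_desc hab' (f ≫ g₂ ≫ g₃ ≫ g₄)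
      (by simpa only [Category.assoc] using h0)
    obtain ⟨z, hz⟩ := hM.exists_pull_eq hT (x - pull k m₄) (by
      rw [pull_sub, ← pull_comp, ← hk, pull_comp, pull_comp, pull_comp, hf, sub_self])
    obtain ⟨l, rfl⟩ := gen₃ z
    exact ⟨k + p ≫ l ≫ g₄, by rw [add_pull, pull_comp, pull_comp, hz, add_sub_cancel]⟩
  · have h1 : (u ≫ f) ≫ g₁ = 0 := kill₁ _ (by rw [pull_comp, hf, pull_zero])
    obtain ⟨k, hk⟩ := compacts_exists_desc hT (f ≫ g₁) (by rwa [← Category.assoc])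
    obtain ⟨x, hx⟩ := hM.exists_pull_eq hab (pull k (pull g₂ (pull g₃ (pull g₄ m₄))))
      (by rw [← pull_comp, ← hk, pull_comp, hf])
    obtain ⟨l, rfl⟩ := gen₂ x
    have h2 : (k ≫ g₂ - a ≫ l) ≫ g₃ = 0 := kill₃ _ (by
      rw [sub_pull, pull_comp, pull_comp, ← hx, sub_self])
    rw [Preadditive.sub_comp, sub_eq_zero, Category.assoc, Category.assoc] at h2
    calc f ≫ g₁ ≫ g₂ ≫ g₃ ≫ g₄ = (f ≫ g₁) ≫ g₂ ≫ g₃ ≫ g₄ := by simp only [Category.assoc]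
      _ = p ≫ (k ≫ g₂ ≫ g₃) ≫ g₄ := by rw [hk]; simp only [Category.assoc]
      _ = (p ≫ a) ≫ l ≫ g₃ ≫ g₄ := by rw [h2]; simp only [Category.assoc]
      _ = 0 := by rw [compacts_comp_eq_zero hab, zero_comp]

theorem HasRefinement.isLocallyCoherentAt {H : Compacts R D} (h : HasRefinement M H) :
    IsLocallyCoherentAt M H := by
  constructor
  · obtain ⟨E, -, m, -, hgen, -⟩ := h H 0
    refine ⟨E, ofElement m, fun x => ?_⟩
    obtain ⟨f, hf⟩ := hgen x
    exact ⟨f.hom, hf⟩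
  · intro E β
    obtain ⟨E', g, m', hg, -, hkill⟩ := h E (β.hom.app (op E) (𝟙 E.obj))
    obtain ⟨C, f, k, hT⟩ := compacts_exists_fiber g
    have hfg := compacts_comp_eq_zero hT
    have hf : pull f (β.hom.app (op E) (𝟙 E.obj)) = 0 := by
      rw [← hg, ← pull_comp, hfg, zero_pull]
    have hpull (K : Compacts R D) (x : K ⟶ C) : β.hom.app (op K) (x.hom ≫ f.hom : K.obj ⟶ E.obj)
        = 0 :=
      (app_eq_pull_id β (x ≫ f)).trans (by rw [pull_comp, hf, pull_zero])
    refine ⟨C, f, ?_, fun x => ⟨fun hx => ?_, ?_⟩⟩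
    · ext K x
      exact hpull K.unop (ObjectProperty.homMk x)
    · obtain ⟨l, hl⟩ := compacts_exists_lift hT (ObjectProperty.homMk x) (hkill _
        ((app_eq_pull_id β (ObjectProperty.homMk (X := H) (Y := E) x)).symm.trans hx))
      exact ⟨l.hom, (congrArg (fun φ => φ.hom) hl).symm⟩
    · rintro ⟨x, rfl⟩
      exact hpull H (ObjectProperty.homMk x)

/-- For the converse direction, add to `E` a compact object generating `M` at `H`, and then pass to
the cone of a map covering the kernel at `H`; the element extends to the cone because `M` is
cohomological. -/
theorem IsLocallyCoherentAt.hasRefinement (hM : IsCohomological M) {H : Compacts R D}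
    (h : IsLocallyCoherentAt M H) : HasRefinement M H := by
  intro E m
  obtain ⟨E₁, α, hα⟩ := h.lc1
  set m₁ := α.hom.app (op E₁) (𝟙 E₁.obj) with hm₁
  let E₂ : Compacts R D := ⟨E.obj ⊞ E₁.obj, (isCompact R).ext_of_isTriangulatedClosed₂ _
    (binaryBiproductTriangle_distinguished _ _) E.property E₁.property⟩
  let i : E ⟶ E₂ := ObjectProperty.homMk biprod.inl
  let i₁ : E₁ ⟶ E₂ := ObjectProperty.homMk biprod.inr
  let q : E₂ ⟶ E := ObjectProperty.homMk biprod.fst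
  let q₁ : E₂ ⟶ E₁ := ObjectProperty.homMk biprod.snd
  have hiq : i ≫ q = 𝟙 E := ObjectProperty.hom_ext _ biprod.inl_fst
  have hiq₁ : i ≫ q₁ = 0 := ObjectProperty.hom_ext _ biprod.inl_snd
  have hi₁q : i₁ ≫ q = 0 := ObjectProperty.hom_ext _ biprod.inr_fst
  have hi₁q₁ : i₁ ≫ q₁ = 𝟙 E₁ := ObjectProperty.hom_ext _ biprod.inr_snd
  let m₂ := pull q m + pull q₁ m₁
  have hi : pull i m₂ = m := by
    rw [pull_add, ← pull_comp, ← pull_comp, hiq, hiq₁, pull_id, zero_pull, add_zero]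
  have hi₁ : pull i₁ m₂ = m₁ := by
    rw [pull_add, ← pull_comp, ← pull_comp, hi₁q, hi₁q₁, pull_id, zero_pull, zero_add]
  obtain ⟨C, f, hf, hex⟩ := h.lc2 E₂ (ofElement m₂)
  obtain ⟨E₃, g, k, hT⟩ := compacts_exists_cone f
  have hf' : pull f m₂ = 0 := by
    have := congrArg (fun φ => ModuleCat.Hom.hom (φ.hom.app (op C)) (𝟙 C.obj)) hf
    refine Eq.trans ?_ this
    change pull f m₂ = pull (ObjectProperty.homMk (𝟙 C.obj ≫ f.hom)) m₂
    rw [Category.id_comp]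
    rfl
  obtain ⟨m₃, hm₃⟩ := hM.exists_pull_eq hT m₂ hf'
  refine ⟨E₃, i ≫ g, m₃, by rw [pull_comp, hm₃, hi], fun x => ?_, fun e he => ?_⟩
  · obtain ⟨e, he⟩ := hα x
    refine ⟨ObjectProperty.homMk e ≫ i₁ ≫ g, ?_⟩
    rw [pull_comp, pull_comp, hm₃, hi₁, hm₁, ← app_eq_pull_id]
    exact he
  · obtain ⟨l, hl⟩ := (hex (e ≫ i).hom).1 (by rw [ofElement_app, pull_comp, hi, he])
    have : e ≫ i = ObjectProperty.homMk l ≫ f := ObjectProperty.hom_ext _ hl.symm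
    rw [← Category.assoc, this, Category.assoc, compacts_comp_eq_zero hT, comp_zero]

theorem isLocallyCoherentAt_iff_hasRefinement (hM : IsCohomological M) {H : Compacts R D} :
    IsLocallyCoherentAt M H ↔ HasRefinement M H :=
  ⟨fun h => h.hasRefinement hM, fun h => h.isLocallyCoherentAt⟩

/-- Local coherence of a cohomological module need only be checked on the shifts of a compact
generator. -/
theorem isLocallyCoherent_of_generator [HasCoproducts.{v} D] {G : Compacts R D}
    (hG : IsCompactGenerator G) (hM : IsCohomological M)
    (h : ∀ n : ℤ, IsLocallyCoherentAt M (shiftCompact G n)) : IsLocallyCoherent M := fun H =>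
  (compacts_induction hG (A := HasRefinement M) (fun _ => hasRefinement_of_isZero)
    HasRefinement.of_retract
    (fun _ _ _ hT hX hZ hX' hZ' => .of_distTriang hM hT hX hZ hX' hZ')
    (fun n => (h n).hasRefinement hM) H).isLocallyCoherentAt

end Refinement

/-! ### Exactness in the category of modules -/

section Exactness

variable {R : Type w} [CommRing R] {D : Type u} [Category.{v} D] [Preadditive D]
  [CategoryTheory.Linear R D] {M N : CompactsMod R D}

theorem surjective_app_of_epi (φ : M ⟶ N) [Epi φ] (K : Compacts R D) :
    Function.Surjective (φ.hom.app (op K)) := by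
  have : (ObjectProperty.ι (C := (Compacts R D)ᵒᵖ ⥤ ModuleCat.{v} R)
      (isLinearFunctor R D)).PreservesEpimorphisms :=
    ObjectProperty.preservesEpimorphisms_ι_of_isNormalMonoCategory _
  have h : Epi φ.hom := inferInstanceAs (Epi (((ObjectProperty.ι
    (C := (Compacts R D)ᵒᵖ ⥤ ModuleCat.{v} R) (isLinearFunctor R D))).map φ))
  rw [NatTrans.epi_iff_epi_app] at h
  exact (ModuleCat.epi_iff_surjective _).1 (h (op K))

theorem epi_of_surjective_app (φ : M ⟶ N)
    (h : ∀ K : Compacts R D, Function.Surjective (φ.hom.app (op K))) : Epi φ := by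
  have (K : (Compacts R D)ᵒᵖ) : Epi (φ.hom.app K) := (ModuleCat.epi_iff_surjective _).2 (h K.unop)
  have : Epi φ.hom := NatTrans.epi_of_epi_app _
  exact (ObjectProperty.ι (C := (Compacts R D)ᵒᵖ ⥤ ModuleCat.{v} R)
    (isLinearFunctor R D)).epi_of_epi_map this

theorem mono_of_injective_app (φ : M ⟶ N)
    (h : ∀ K : Compacts R D, Function.Injective (φ.hom.app (op K))) : Mono φ := by
  have (K : (Compacts R D)ᵒᵖ) : Mono (φ.hom.app K) := (ModuleCat.mono_iff_injective _).2 (h K.unop)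
  have : Mono φ.hom := NatTrans.mono_of_mono_app _
  exact (ObjectProperty.ι (C := (Compacts R D)ᵒᵖ ⥤ ModuleCat.{v} R)
    (isLinearFunctor R D)).mono_of_mono_map this

theorem exact_of_evaluation {C : Type*} [Category* C] {A : Type*} [Category* A] [Abelian A]
    (S : ShortComplex (C ⥤ A)) (h : ∀ K : C, (S.map ((evaluation C A).obj K)).Exact) :
    S.Exact := by
  rw [ShortComplex.exact_iff_isZero_homology]
  refine Functor.isZero _ fun K => ?_
  exact ((ShortComplex.exact_iff_isZero_homology _).1 (h K)).of_iso
    (S.mapHomologyIso ((evaluation C A).obj K)).symm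

/-- Exactness in `Mod-D^c` may be checked objectwise. -/
theorem exact_of_app (S : ShortComplex (CompactsMod R D))
    (h : ∀ (K : Compacts R D) (x : S.X₂.obj.obj (op K)), S.g.hom.app (op K) x = 0 →
      ∃ y, S.f.hom.app (op K) y = x) : S.Exact := by
  let ι := ObjectProperty.ι (C := (Compacts R D)ᵒᵖ ⥤ ModuleCat.{v} R) (isLinearFunctor R D)
  have : ι.PreservesHomology :=
    { preservesKernels := ObjectProperty.preservesKernels_ι _
      preservesCokernels := ObjectProperty.preservesCokernels_ι _ }
  rw [← S.exact_map_iff_of_faithful ι]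
  refine exact_of_evaluation _ fun K => ?_
  rw [ShortComplex.moduleCat_exact_iff]
  exact h K.unop

end Exactness

/-! ### Coproducts of representable modules -/

section RepresentableCoproduct

variable {R : Type w} [CommRing R] {D : Type u} [Category.{v} D] [Preadditive D]
  [CategoryTheory.Linear R D] {M : CompactsMod R D} {J : Type*} [Small.{v} J]
  {C : J → Compacts R D} {c : Cofan fun j => (C j).obj} (hc : IsColimit c)

include hc

/-- `y (∐ C j)` is the coproduct of the representable modules `y (C j)`: elements of `M` at the
`C j` determine a map to `M`. -/
theorem exists_desc_restrictedYoneda (m : ∀ j, M.obj.obj (op (C j))) :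
    ∃ ψ : (restrictedYoneda R D).obj c.pt ⟶ M, ∀ j, ψ.hom.app (op (C j)) (c.inj j) = m j := by
  let t (K : Compacts R D) : (K.obj ⟶ c.pt) →ₗ[R] M.obj.obj (op K) :=
    cofanDescLinear hc (fun f => K.property.exists_cofanTrunc hc f) fun j => pullLinear K (m j)
  have ht (K : Compacts R D) {j : J} (f : K ⟶ C j) : t K (f.hom ≫ c.inj j) = pull f (m j) :=
    cofanDescLinear_comp_inj hc (fun f => K.property.exists_cofanTrunc hc f)
      (fun j => pullLinear K (m j)) f.hom
  refine ⟨ObjectProperty.homMk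
    { app := fun K => ModuleCat.ofHom (t K.unop)
      naturality := fun K K' f => ModuleCat.hom_ext ?_ }, fun j => ?_⟩
  · refine addMonoidHom_ext_of_inj (F := (K.unop.obj ⟶ c.pt) →ₗ[R] M.obj.obj K') hc
      (fun f => K.unop.property.exists_cofanTrunc hc f) fun j g => ?_
    change t K'.unop (f.unop.hom ≫ g ≫ c.inj j) = pull f.unop (t K.unop (g ≫ c.inj j))
    rw [← Category.assoc]
    refine (ht K'.unop (f.unop ≫ ObjectProperty.homMk g)).trans ?_
    rw [pull_comp]
    exact congrArg _ (ht K.unop (ObjectProperty.homMk g)).symm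
  · refine Eq.trans ?_ ((ht (C j) (𝟙 _)).trans (pull_id _))
    exact congrArg (t (C j)) (Category.id_comp (c.inj j)).symm

theorem restrictedYoneda_coproduct_hom_ext {ψ ψ' : (restrictedYoneda R D).obj c.pt ⟶ M}
    (h : ∀ j, ψ.hom.app (op (C j)) (c.inj j) = ψ'.hom.app (op (C j)) (c.inj j)) : ψ = ψ' := by
  refine ObjectProperty.hom_ext _ (NatTrans.ext (funext fun K => ModuleCat.hom_ext ?_))
  refine addMonoidHom_ext_of_inj (F := (K.unop.obj ⟶ c.pt) →ₗ[R] M.obj.obj K) hc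
    (fun f => K.unop.property.exists_cofanTrunc hc f) fun j g => ?_
  refine (app_eq_pull ψ (ObjectProperty.homMk g : K.unop ⟶ C j) (c.inj j)).trans ?_
  rw [h]
  exact (app_eq_pull ψ' (ObjectProperty.homMk g : K.unop ⟶ C j) (c.inj j)).symm

theorem projective_restrictedYoneda_coproduct :
    Projective ((restrictedYoneda R D).obj c.pt) where
  factors {A B} φ e _ := by
    choose a ha using fun j =>
      surjective_app_of_epi e (C j) (φ.hom.app (op (C j)) (c.inj j))
    obtain ⟨ψ, hψ⟩ := exists_desc_restrictedYoneda hc a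
    refine ⟨ψ, restrictedYoneda_coproduct_hom_ext hc fun j => ?_⟩
    exact (congrArg (e.hom.app (op (C j))) (hψ j)).trans (ha j)

end RepresentableCoproduct

/-! ### The module of a homotopy colimit -/

section ModuleHomotopyColimit

variable {R : Type w} [CommRing R] {D : Type u} [Category.{v} D] [Preadditive D]
  [CategoryTheory.Linear R D] [HasZeroObject D] [HasShift D ℤ]
  [∀ n : ℤ, (shiftFunctor D n).Additive] [Pretriangulated D]
  [∀ n : ℤ, (shiftFunctor D n).Linear R] {M : CompactsMod R D}
  {C : ℕ → Compacts R D} (d : ∀ n, C n ⟶ C (n + 1)) {c : Cofan fun n => (C n).obj}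
  (hc : IsColimit c) {Y : D} {p : c.pt ⟶ Y} {δ : Y ⟶ c.pt⟦(1 : ℤ)⟧}
  (hT : Triangle.mk (oneSubShift (fun n => (d n).hom) hc) p δ ∈ distTriang D)

/-- The restricted Yoneda functor applied to the triangle of a homotopy colimit. -/
noncomputable def hocolimShortComplex : ShortComplex (CompactsMod R D) :=
  ShortComplex.mk ((restrictedYoneda R D).map (oneSubShift (fun n => (d n).hom) hc))
    ((restrictedYoneda R D).map p) (by
      rw [← Functor.map_comp, oneSubShift_comp_of_distTriang _ hc hT]
      ext K (x : K.unop.obj ⟶ c.pt)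
      exact comp_zero)

/-- On compact objects, the long exact sequence of the triangle of a homotopy colimit breaks up
into short exact sequences, giving a projective resolution of length one. -/
theorem shortExact_hocolimShortComplex : (hocolimShortComplex d hc hT).ShortExact where
  exact := exact_of_app _ fun K (x : K.obj ⟶ c.pt) hx => by
    obtain ⟨y, hy⟩ := Triangle.coyoneda_exact₂ _ hT x hx
    exact ⟨y, hy.symm⟩
  mono_f := mono_of_injective_app _ fun K =>
    (injective_iff_map_eq_zero _).2 fun (_ : K.obj ⟶ c.pt) hx =>
      eq_zero_of_comp_oneSubShift _ hc K.property hx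
  epi_g := epi_of_surjective_app _ fun K (x : K.obj ⟶ Y) =>
    exists_lift_of_isCompact _ hc hT K.property x

include hc hT

theorem hasProjectiveDimensionLE_one_of_hocolim :
    HasProjectiveDimensionLE ((restrictedYoneda R D).obj Y) 1 := by
  have h : Projective ((restrictedYoneda R D).obj c.pt) :=
    projective_restrictedYoneda_coproduct hc
  have h1 : HasProjectiveDimensionLT ((restrictedYoneda R D).obj c.pt) 1 := inferInstance
  exact (shortExact_hocolimShortComplex d hc hT).hasProjectiveDimensionLT_X₃ 1 h1
    (@hasProjectiveDimensionLT_of_ge _ _ _ ((restrictedYoneda R D).obj c.pt) 1 2 one_le_two h1)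

/-- `y Y` is the colimit of the representable modules `y (C n)`: a compatible family of elements
of `M` at the `C n` determines a map `y Y ⟶ M`. -/
theorem exists_desc_hocolim (m : ∀ n, M.obj.obj (op (C n)))
    (hm : ∀ n, pull (d n) (m (n + 1)) = m n) :
    ∃ φ : (restrictedYoneda R D).obj Y ⟶ M,
      ∀ n, φ.hom.app (op (C n)) (c.inj n ≫ p : (C n).obj ⟶ Y) = m n := by
  obtain ⟨ψ, hψ⟩ := exists_desc_restrictedYoneda hc m
  have h0 : (restrictedYoneda R D).map (oneSubShift (fun n => (d n).hom) hc) ≫ ψ = 0 := by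
    refine restrictedYoneda_coproduct_hom_ext hc fun n => ?_
    change ψ.hom.app (op (C n)) (c.inj n ≫ oneSubShift (fun n => (d n).hom) hc :
      (C n).obj ⟶ c.pt) = 0
    rw [inj_oneSubShift]
    refine (map_sub (ψ.hom.app (op (C n))).hom (c.inj n) ((d n).hom ≫ c.inj (n + 1))).trans ?_
    refine (congrArg₂ (· - ·) (hψ n) ((app_eq_pull ψ (d n) (c.inj (n + 1))).trans
      ((congrArg (pull (d n)) (hψ (n + 1))).trans (hm n)))).trans (sub_self _)
  have hS := shortExact_hocolimShortComplex d hc hT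
  have := hS.epi_g
  obtain ⟨φ, hφ⟩ := hS.exact.desc' ψ h0
  refine ⟨φ, fun n => ?_⟩
  rw [← hψ n, ← hφ]
  rfl

end ModuleHomotopyColimit

/-! ### Approximation by a sequence of compact objects -/

section Approximation

variable {R : Type w} [CommRing R] {D : Type u} [Category.{v} D] [Preadditive D]
  [CategoryTheory.Linear R D]

theorem transition_hom {C : ℕ → Compacts R D} (d : ∀ n, C n ⟶ C (n + 1)) {n k : ℕ} (h : n ≤ k) :
    (transition d h).hom = transition (fun n => (d n).hom) h := by
  induction k, h using Nat.le_induction with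
  | base =>
    rw [transition_refl, transition_refl]
    rfl
  | succ k h ih =>
    rw [← transition_comp d h (Nat.le_succ k), ← transition_comp _ h (Nat.le_succ k),
      transition_succ, transition_succ, ← ih]
    rfl

theorem pull_transition {M : CompactsMod R D} {C : ℕ → Compacts R D} {d : ∀ n, C n ⟶ C (n + 1)}
    {m : ∀ n, M.obj.obj (op (C n))} (hm : ∀ n, pull (d n) (m (n + 1)) = m n) {n k : ℕ}
    (h : n ≤ k) : pull (transition d h) (m k) = m n := by
  induction k, h using Nat.le_induction with
  | base => rw [transition_refl, pull_id]
  | succ k h ih =>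
    rw [← transition_comp d h (Nat.le_succ k), transition_succ, pull_comp, hm, ih]

variable [HasShift D ℤ] [∀ n : ℤ, (shiftFunctor D n).Additive]
  [∀ n : ℤ, (shiftFunctor D n).Linear R]

/-- A sequence `C 0 ⟶ C 1 ⟶ ⋯` of compact objects with a compatible family of elements of `M`,
such that `colim D(G[i], C n) ⟶ M(G[i])` is bijective for every integer `i`. -/
structure IsApproximation (G : Compacts R D) {M : CompactsMod R D} {C : ℕ → Compacts R D}
    (d : ∀ n, C n ⟶ C (n + 1)) (m : ∀ n, M.obj.obj (op (C n))) : Prop where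
  pull_succ : ∀ n, pull (d n) (m (n + 1)) = m n
  generates : ∀ (i : ℤ) (x : M.obj.obj (op (shiftCompact G i))),
    ∃ (n : ℕ) (f : shiftCompact G i ⟶ C n), pull f (m n) = x
  kills : ∀ (i : ℤ) (n : ℕ) (f : shiftCompact G i ⟶ C n), pull f (m n) = 0 →
    ∃ (k : ℕ) (h : n ≤ k), f ≫ transition d h = 0

/-- Refine at the shifts `G[e k]` successively, where `e : ℕ → ℤ` takes each value infinitely
often. -/
theorem exists_isApproximation [HasZeroObject D] [Pretriangulated D] {G : Compacts R D}
    {M : CompactsMod R D} (hM : ∀ n : ℤ, HasRefinement M (shiftCompact G n)) :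
    ∃ (C : ℕ → Compacts R D) (d : ∀ n, C n ⟶ C (n + 1)) (m : ∀ n, M.obj.obj (op (C n))),
      IsApproximation G d m := by
  choose E' g m' hg hgen hkill using hM
  let e (k : ℕ) : ℤ := Denumerable.ofNat ℤ k.unpair.2
  have he (i : ℤ) (n : ℕ) : ∃ k, n ≤ k ∧ e k = i :=
    ⟨Nat.pair n (Encodable.encode i), Nat.left_le_pair _ _, by
      simp only [e, Nat.unpair_pair, Denumerable.ofNat_encode]⟩
  let S := Σ E : Compacts R D, M.obj.obj (op E)
  let s : ℕ → S := fun n => Nat.rec (⟨G, 0⟩ : S) (fun k t => ⟨E' (e k) t.1 t.2, m' (e k) t.1 t.2⟩) n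
  let d (n : ℕ) : (s n).1 ⟶ (s (n + 1)).1 := g (e n) (s n).1 (s n).2
  have hd (n : ℕ) : pull (d n) (s (n + 1)).2 = (s n).2 := hg (e n) (s n).1 (s n).2
  refine ⟨fun n => (s n).1, d, fun n => (s n).2, hd, fun i x => ?_, fun i n f hf => ?_⟩
  · obtain ⟨k, -, rfl⟩ := he i 0
    exact ⟨k + 1, hgen (e k) (s k).1 (s k).2 x⟩
  · obtain ⟨k, hk, rfl⟩ := he i n
    refine ⟨k + 1, hk.trans (Nat.le_succ k), ?_⟩
    rw [← transition_comp d hk (Nat.le_succ k), transition_succ, ← Category.assoc]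
    exact hkill (e k) (s k).1 (s k).2 _ (by
      rw [pull_comp, pull_transition (m := fun n => (s n).2) hd hk, hf])

variable [HasZeroObject D] [Pretriangulated D]

theorem IsApproximation.bijective_app {G : Compacts R D} {M : CompactsMod R D}
    {C : ℕ → Compacts R D} {d : ∀ n, C n ⟶ C (n + 1)} {m : ∀ n, M.obj.obj (op (C n))}
    (h : IsApproximation G d m) {c : Cofan fun n => (C n).obj} (hc : IsColimit c) {Y : D}
    {p : c.pt ⟶ Y} {δ : Y ⟶ c.pt⟦(1 : ℤ)⟧}
    (hT : Triangle.mk (oneSubShift (fun n => (d n).hom) hc) p δ ∈ distTriang D)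
    (φ : (restrictedYoneda R D).obj Y ⟶ M)
    (hφ : ∀ n, φ.hom.app (op (C n)) (c.inj n ≫ p : (C n).obj ⟶ Y) = m n) (i : ℤ) :
    Function.Bijective (φ.hom.app (op (shiftCompact G i))) := by
  have hφ' (n : ℕ) (f : shiftCompact G i ⟶ C n) : φ.hom.app (op (shiftCompact G i))
      (f.hom ≫ c.inj n ≫ p : (shiftCompact G i).obj ⟶ Y) = pull f (m n) := by
    rw [← hφ]
    exact app_eq_pull φ f (c.inj n ≫ p : (C n).obj ⟶ Y)
  constructor
  · refine (injective_iff_map_eq_zero _).2 fun (y : (shiftCompact G i).obj ⟶ Y) hy => ?_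
    obtain ⟨n, f, rfl⟩ := exists_factor_stage _ hc hT (shiftCompact G i).property y
    obtain ⟨k, hk, h0⟩ := h.kills i n (ObjectProperty.homMk f)
      ((hφ' n (ObjectProperty.homMk f)).symm.trans hy)
    have h0' : f ≫ transition (fun n => (d n).hom) hk = 0 := by
      rw [← transition_hom]
      exact congrArg (fun φ => φ.hom) h0
    rw [inj_comp_eq_transition _ hc (oneSubShift_comp_of_distTriang _ hc hT) hk]
    refine (Category.assoc _ _ _).symm.trans ?_
    rw [h0', zero_comp]
    rfl
  · intro x
    obtain ⟨n, f, rfl⟩ := h.generates i x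
    exact ⟨(f.hom ≫ c.inj n ≫ p : (shiftCompact G i).obj ⟶ Y), hφ' n f⟩

/-- Restricted Yoneda reflects isomorphisms: the cone `W` of `g` receives no map from a shift of
the generator, because `D(K, X) ⟶ D(K, W)` and `D(K, W) ⟶ D(K, Y[1])` vanish for compact `K`. -/
theorem isIso_of_isIso_restrictedYoneda_map {G : Compacts R D} (hG : IsCompactGenerator G)
    {X Y : D} (g : Y ⟶ X) [IsIso ((restrictedYoneda R D).map g)] : IsIso g := by
  have hbij (K : Compacts R D) : Function.Bijective fun f : K.obj ⟶ Y => f ≫ g := by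
    have h : IsIso (((restrictedYoneda R D).map g).hom.app (op K)) := inferInstance
    exact (ConcreteCategory.isIso_iff_bijective _).1 h
  obtain ⟨W, a, b, hT⟩ := distinguished_cocone_triangle g
  have hga : g ≫ a = 0 := comp_distTriang_mor_zero₁₂ _ hT
  have hbg : b ≫ g⟦(1 : ℤ)⟧' = 0 := comp_distTriang_mor_zero₃₁ _ hT
  refine (Triangle.isZero₃_iff_isIso₁ _ hT).1 (hG W fun i f => ?_)
  have hfb : f ≫ b = 0 := by
    obtain ⟨k, hk⟩ := exists_transpose (f ≫ b)
    have h1 := (hk g 0).1 (by rw [Category.assoc, hbg, Functor.map_zero, comp_zero, comp_zero])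
    have h2 : k = 0 := (hbij (shiftCompact (shiftCompact G i) (-1))).1
      (h1.trans (comp_zero.trans zero_comp.symm))
    have h3 := (hk (𝟙 _) 0).2 (by rw [h2, zero_comp, zero_comp])
    rwa [CategoryTheory.Functor.map_id, Category.comp_id, Functor.map_zero, comp_zero] at h3
  obtain ⟨l, hl⟩ := Triangle.coyoneda_exact₃ _ hT f hfb
  obtain ⟨l', hl'⟩ := (hbij (shiftCompact G i)).2 l
  change l' ≫ g = l at hl'
  rw [hl, ← hl']
  change (l' ≫ g) ≫ a = 0
  rw [Category.assoc, hga, comp_zero]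

variable [HasCoproducts.{v} D] {G : Compacts R D}

/-- A cohomological module that is locally coherent at the shifts of the generator is the
restricted Yoneda module of a homotopy colimit of compact objects. -/
theorem exists_iso_hocolim (hG : IsCompactGenerator G) {M : CompactsMod R D}
    (hM : IsCohomological M) (h : ∀ n : ℤ, IsLocallyCoherentAt M (shiftCompact G n)) :
    ∃ (C : ℕ → Compacts R D) (d : ∀ n, C n ⟶ C (n + 1)) (c : Cofan fun n => (C n).obj)
      (hc : IsColimit c) (Y : D) (p : c.pt ⟶ Y) (δ : Y ⟶ c.pt⟦(1 : ℤ)⟧),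
      Triangle.mk (oneSubShift (fun n => (d n).hom) hc) p δ ∈ distTriang D ∧
        Nonempty ((restrictedYoneda R D).obj Y ≅ M) := by
  obtain ⟨C, d, m, hm⟩ := exists_isApproximation fun n => (h n).hasRefinement hM
  obtain ⟨c, hc, Y, p, δ, hT⟩ := exists_hocolim (fun n => (C n).obj) fun n => (d n).hom
  obtain ⟨φ, hφ⟩ := exists_desc_hocolim d hc hT m hm.pull_succ
  have := isIso_of_bijective_on_generator hG (isCohomological_restrictedYoneda Y) hM φ
    (hm.bijective_app hc hT φ hφ)
  exact ⟨C, d, c, hc, Y, p, δ, hT, ⟨asIso φ⟩⟩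

/-- Objects of `D_lcoh` are homotopy colimits of sequences of compact objects. -/
theorem lcoh.exists_distTriang (hG : IsCompactGenerator G) {X : D} (hX : lcoh (R := R) G X) :
    ∃ (C : ℕ → Compacts R D) (d : ∀ n, C n ⟶ C (n + 1)) (c : Cofan fun n => (C n).obj)
      (hc : IsColimit c) (p : c.pt ⟶ X) (δ : X ⟶ c.pt⟦(1 : ℤ)⟧),
      Triangle.mk (oneSubShift (fun n => (d n).hom) hc) p δ ∈ distTriang D := by
  have hM := isCohomological_restrictedYoneda (R := R) X
  obtain ⟨C, d, m, hm⟩ := exists_isApproximation fun n => (hX n).hasRefinement hM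
  obtain ⟨c, hc, Y, p, δ, hT⟩ := exists_hocolim (fun n => (C n).obj) fun n => (d n).hom
  let m' (n : ℕ) : (C n).obj ⟶ X := m n
  have hm' (n : ℕ) : (d n).hom ≫ m' (n + 1) = m' n := hm.pull_succ n
  let q : c.pt ⟶ X := Cofan.IsColimit.desc hc m'
  have hq (n : ℕ) : c.inj n ≫ q = m' n := Cofan.IsColimit.fac hc m' n
  obtain ⟨g : Y ⟶ X, hg⟩ := Triangle.yoneda_exact₂ _ hT q
    (oneSubShift_comp_eq_zero (fun n => (d n).hom) hc fun n => by rw [hq, hq, hm'])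
  change q = p ≫ g at hg
  have hφ (n : ℕ) : ((restrictedYoneda R D).map g).hom.app (op (C n))
      (c.inj n ≫ p : (C n).obj ⟶ Y) = m n := by
    change (c.inj n ≫ p) ≫ g = m' n
    rw [Category.assoc, ← hg, hq]
  have := isIso_of_bijective_on_generator hG (isCohomological_restrictedYoneda Y) hM _
    (hm.bijective_app hc hT _ hφ)
  have := isIso_of_isIso_restrictedYoneda_map hG g
  have hpg : (p ≫ g) ≫ inv g = p := by rw [Category.assoc, IsIso.hom_inv_id, Category.comp_id]
  exact ⟨C, d, c, hc, p ≫ g, inv g ≫ δ, isomorphic_distinguished _ hT _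
    (Triangle.isoMk _ _ (Iso.refl _) (Iso.refl _) (asIso g).symm
      ((Category.comp_id _).trans (Category.id_comp _).symm)
      (hpg.trans (Category.id_comp _).symm)
      ((congrArg ((inv g ≫ δ) ≫ ·) (CategoryTheory.Functor.map_id _ _)).trans
        (Category.comp_id _)))⟩

/-- A morphism `y X ⟶ y X'` is a compatible family of maps `C n ⟶ X'` when `X` is a homotopy
colimit of compact objects `C n`, and such a family extends to `X`. -/
theorem restrictedYoneda_map_surjective (hG : IsCompactGenerator G) {X X' : D}
    (hX : lcoh (R := R) G X) (φ : (restrictedYoneda R D).obj X ⟶ (restrictedYoneda R D).obj X') :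
    ∃ g : X ⟶ X', (restrictedYoneda R D).map g = φ := by
  obtain ⟨C, d, c, hc, p, δ, hT⟩ := hX.exists_distTriang hG
  let m (n : ℕ) : (C n).obj ⟶ X' := φ.hom.app (op (C n)) (c.inj n ≫ p : (C n).obj ⟶ X)
  have hp := oneSubShift_comp_of_distTriang _ hc hT
  have hm (n : ℕ) : (d n).hom ≫ m (n + 1) = m n := by
    refine (app_eq_pull φ (d n) (c.inj (n + 1) ≫ p)).symm.trans ?_
    have := inj_comp_eq_transition _ hc hp (Nat.le_succ n)
    rw [transition_succ] at this
    rw [← this]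
  let q : c.pt ⟶ X' := Cofan.IsColimit.desc hc m
  have hq (n : ℕ) : c.inj n ≫ q = m n := Cofan.IsColimit.fac hc m n
  obtain ⟨g : X ⟶ X', hg⟩ := Triangle.yoneda_exact₂ _ hT q
    (oneSubShift_comp_eq_zero (fun n => (d n).hom) hc fun n => by rw [hq, hq, hm])
  change q = p ≫ g at hg
  refine ⟨g, ObjectProperty.hom_ext _ (NatTrans.ext (funext fun K => ModuleCat.hom_ext
    (LinearMap.ext fun (f : K.unop.obj ⟶ X) => ?_)))⟩
  obtain ⟨n, f, rfl⟩ := exists_factor_stage _ hc hT K.unop.property f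
  refine Eq.trans ?_ (app_eq_pull φ (ObjectProperty.homMk f : K.unop ⟶ C n) (c.inj n ≫ p)).symm
  change (f ≫ c.inj n ≫ p) ≫ g = f ≫ m n
  rw [Category.assoc, Category.assoc, ← hg, hq]

end Approximation

end LocallyCoherent

theorem theoremt {R : Type w} [CommRing R] {D : Type u} [Category.{v} D] [Preadditive D]
    [CategoryTheory.Linear R D] [HasZeroObject D] [HasShift D ℤ]
    [∀ n : ℤ, (shiftFunctor D n).Additive] [∀ n : ℤ, (shiftFunctor D n).Linear R]
    [Pretriangulated D] [IsTriangulated D] [HasCoproducts.{v} D]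
    (G : LocallyCoherent.Compacts R D) (hG : LocallyCoherent.IsCompactGenerator G) :
    (∀ X : D, LocallyCoherent.lcoh G X →
      ∃ (C : ℕ → D) (d : ∀ n, C n ⟶ C (n + 1)),
        (∀ n, LocallyCoherent.isCompact R (C n)) ∧
          LocallyCoherent.IsHomotopyColimit C d X) ∧
    ((LocallyCoherent.lcoh G).ι ⋙ LocallyCoherent.restrictedYoneda R D).Full ∧
    (∀ M : LocallyCoherent.CompactsMod R D,
      ((LocallyCoherent.lcoh G).ι ⋙ LocallyCoherent.restrictedYoneda R D).essImage M ↔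
        LocallyCoherent.IsCohomological M ∧ LocallyCoherent.IsLocallyCoherent M) ∧
    (∀ M : LocallyCoherent.CompactsMod R D,
      LocallyCoherent.IsCohomological M → LocallyCoherent.IsLocallyCoherent M →
        HasProjectiveDimensionLE M 1) := by
  refine ⟨fun X hX => ?_, ⟨fun {X _} φ => ?_⟩, fun M => ⟨?_, fun ⟨hM, hM'⟩ => ?_⟩,
    fun M hM hM' => ?_⟩
  · obtain ⟨C, d, c, hc, p, δ, hT⟩ := hX.exists_distTriang hG
    exact ⟨fun n => (C n).obj, fun n => (d n).hom, fun n => (C n).property, c, hc, p, δ, hT⟩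
  · obtain ⟨g, hg⟩ := LocallyCoherent.restrictedYoneda_map_surjective hG X.property φ
    exact ⟨ObjectProperty.homMk g, hg⟩
  · rintro ⟨X, ⟨e⟩⟩
    have hX := LocallyCoherent.isCohomological_restrictedYoneda (R := R) X.obj
    exact ⟨hX.of_iso e, fun H =>
      (LocallyCoherent.isLocallyCoherent_of_generator hG hX X.property H).of_iso e⟩
  · obtain ⟨C, d, c, hc, Y, p, δ, hT, ⟨e⟩⟩ :=
      LocallyCoherent.exists_iso_hocolim hG hM fun n => hM' _
    exact ⟨⟨Y, fun n => (hM' _).of_iso e.symm⟩, ⟨e⟩⟩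
  · obtain ⟨C, d, c, hc, Y, p, δ, hT, ⟨e⟩⟩ :=
      LocallyCoherent.exists_iso_hocolim hG hM fun n => hM' _
    have := LocallyCoherent.hasProjectiveDimensionLE_one_of_hocolim d hc hT
    exact hasProjectiveDimensionLT_of_iso e 2
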